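/- For $n\ge 2$ let $L_n$ be the ladder graph with $n$ rungs, i.e. the graph with $2n$ vertices $p_1,\dots,p_n,q_1,\dots,q_n$ and the $3n-2$ edges $p_iq_i$ ($1\le i\le n$), $p_ip_{i+1}$ and $q_iq_{i+1}$ ($1\le i\le n-1$), regarded as a metrized graph in which every edge is a segment of length $1$. For a connected metrized graph $\Gamma$ with vertex set $V$ and edge set $E$, let $g=|E|-|V|+1$ be its genus, $\ell$ its total length, $v(p)$ the valence of a vertex $p$, and $r(x,y)$ the effective resistance between points $x,y\in\Gamma$ (resistance along edges being length). For an edge $e$ of length $L_e$ let $R_e\in[0,\infty]$ be the effective resistance between the end points of $e$ in $\Gamma$ with the interior of $e$ removed. For $g\ge 1$ let $\mu_{ad}=\frac1g\sum_{e\in E}\frac{dx|_e}{L_e+R_e}$ be the admissible measure (for the canonical divisor $K=\sum_{p\in V}(v(p)-2)\,p$, all vertices having weight $0$), let $\delta_K=\sum_{p\in V}(v(p)-2)\,\delta_p$, and put $$\epsilon(\Gamma)=\iint r(x,y)\,\delta_K(x)\,\mu_{ad}(y),\qquad Z(\Gamma)=\frac12\iint r(x,y)\,\mu_{ad}(x)\,\mu_{ad}(y),$$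 $$\varphi(\Gamma)=3g\,Z(\Gamma)-\frac{\epsilon(\Gamma)+\ell}{4},\qquad \lambda(\Gamma)=\frac{g-1}{6(2g+1)}\,\varphi(\Gamma)+\frac{\epsilon(\Gamma)+\ell}{12}.$$ **Theorem.** For every integer $n\ge 2$, the metrized graph $L_n$ has genus $n-1$, and $$\begin{aligned} \varphi(L_n) &= \frac{3n^3-9n^2-5n+1}{18(n-1)}+\frac{(n-6)(2n-1)}{6\sqrt3\,(n-1)}\left[1-\frac{2}{1-(2-\sqrt3)^{2n}}\right],\\ \lambda(L_n) &= \frac{n(n+4)(n-1)}{12(2n-1)},\\ \epsilon(L_n) &= \frac{(3n^2-3n+10)(n-2)}{9(n-1)}-\frac{(n-2)(n-6)}{3\sqrt3\,(n-1)}\left[1-\frac{2}{1-(2-\sqrt3)^{2n}}\right],\\ Z(L_n) &= \frac{(3n^2-13)\,n}{36(n-1)^2}+\frac{n(n-6)}{12\sqrt3\,(n-1)^2}\left[1-\frac{2}{1-(2-\sqrt3)^{2n}}\right]. \end{aligned}$$ -/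

import Mathlib

open MeasureTheory Set
open scoped ENNReal

noncomputable section

/-- A model of a metrized graph: a finite multigraph (loops and multiple edges allowed), given by
its vertices `V`, its edges `E`, the two end points of each edge (the orientation only serves to
parametrize the edge), and a positive length for each edge. In the associated metrized graph the
edge `e` is a segment of length `len e`, running from `src e` to `tgt e`. -/
structure MetrizedGraph (V E : Type) where
  src : E → V
  tgt : E → V
  len : E → ℝ
  len_pos : ∀ e, 0 < len e

namespace MetrizedGraph

variable {V E : Type}

/-- The points of the metrized graph: the vertices, and the interior points of the edges.
`interior e t` is the point of the edge `e` at distance `t` (along `e`) from `src e`. -/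
inductive Point (G : MetrizedGraph V E) : Type
  | vertex (v : V) : Point G
  | interior (e : E) (t : Ioo (0 : ℝ) (G.len e)) : Point G

/-- The Borel sets of the metrized graph: a set is measurable when its trace on each of the
(finitely many) open edges is a Borel set; there is no condition at the vertices. -/
instance (G : MetrizedGraph V E) : MeasurableSpace G.Point :=
  ⨅ e : E, (inferInstance : MeasurableSpace (Ioo (0 : ℝ) (G.len e))).map (Point.interior e)

/-- A function of finite Dirichlet energy on the metrized graph, i.e. a continuous function which
on each edge is the integral of a square integrable slope (derivative in the direction from `src e`
to `tgt e`). Continuous piecewise affine functions are examples. -/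
structure EnergyFunction (G : MetrizedGraph V E) where
  toFun : G.Point → ℝ
  slope : E → ℝ → ℝ
  slope_memLp : ∀ e, MemLp (slope e) 2 (volume.restrict (Ioo 0 (G.len e)))
  value_interior : ∀ (e : E) (t : Ioo (0 : ℝ) (G.len e)),
    toFun (.interior e t) = toFun (.vertex (G.src e)) + ∫ s in (0 : ℝ)..(t : ℝ), slope e s
  value_tgt : ∀ e : E,
    toFun (.vertex (G.tgt e)) = toFun (.vertex (G.src e)) + ∫ s in (0 : ℝ)..G.len e, slope e s

/-- The Dirichlet form: the integral of `f' h'` over the metrized graph. -/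
def dirichlet [Fintype E] (G : MetrizedGraph V E) (f h : G.EnergyFunction) : ℝ :=
  ∑ e, ∫ t in (0 : ℝ)..G.len e, f.slope e t * h.slope e t

/-- `f` is a voltage for the unit current that enters at `x` and leaves at `y`, where the
resistance of a segment is its length. This is Poisson's equation `Δ f = δ_x - δ_y`
(Ohm's and Kirchhoff's laws), with `Δ` the Laplacian of the metrized graph, in weak form. -/
def IsUnitVoltage [Fintype E] (G : MetrizedGraph V E) (x y : G.Point)
    (f : G.EnergyFunction) : Prop :=
  ∀ h : G.EnergyFunction, G.dirichlet f h = h.toFun x - h.toFun y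

/-- The effective resistance between two points, in `[0, ∞]`: the drop of voltage from `x` to `y`
when a unit current enters at `x` and leaves at `y`. All voltages `f` for this current have the same
drop, so the infimum only selects their common value; it is `∞` when no such current exists,
i.e. when `x` and `y` lie in different components. -/
def eResistance [Fintype E] (G : MetrizedGraph V E) (x y : G.Point) : ℝ≥0∞ :=
  ⨅ (f : G.EnergyFunction) (_ : G.IsUnitVoltage x y f), ENNReal.ofReal (f.toFun x - f.toFun y)

/-- The effective resistance `r(x, y)` as a real number. -/
def resistance [Fintype E] (G : MetrizedGraph V E) (x y : G.Point) : ℝ :=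
  (G.eResistance x y).toReal

/-- The graph obtained by deleting the interior of the edge `e`. -/
def deleteEdge (G : MetrizedGraph V E) (e : E) : MetrizedGraph V {e' : E // e' ≠ e} where
  src e' := G.src e'
  tgt e' := G.tgt e'
  len e' := G.len e'
  len_pos e' := G.len_pos e'

/-- The resistance `R_e` between the end points of `e` in the graph with the interior of `e`
deleted; it is `∞` if `e` is a bridge. -/
def deletedResistance [Fintype E] [DecidableEq E] (G : MetrizedGraph V E) (e : E) : ℝ≥0∞ :=
  (G.deleteEdge e).eResistance (.vertex (G.src e)) (.vertex (G.tgt e))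

/-- The total length `ℓ`. -/
def totalLength [Fintype E] (G : MetrizedGraph V E) : ℝ := ∑ e, G.len e

/-- The genus `g = |E| - |V| + 1` of a connected graph. -/
def genus [Fintype V] [Fintype E] (_G : MetrizedGraph V E) : ℝ :=
  (Fintype.card E : ℝ) - (Fintype.card V : ℝ) + 1

/-- The valence `v(p)` of a vertex, loops being counted twice. -/
def valence [Fintype E] [DecidableEq V] (G : MetrizedGraph V E) (p : V) : ℕ :=
  (Finset.univ.filter fun e => G.src e = p).card + (Finset.univ.filter fun e => G.tgt e = p).card

/-- The admissible measure `μ_ad = (1 / g) ∑ e, dx / (L_e + R_e)`, where `dx` is the Lebesgue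
measure on the edge `e` (and the term of `e` is zero if `e` is a bridge). This is the admissible
measure for the canonical divisor `K = ∑ p, (v(p) - 2) p`, all vertices having weight zero. -/
def admissibleMeasure [Fintype V] [Fintype E] [DecidableEq E] (G : MetrizedGraph V E) :
    Measure G.Point :=
  (ENNReal.ofReal G.genus)⁻¹ • ∑ e : E, (ENNReal.ofReal (G.len e) + G.deletedResistance e)⁻¹ •
    Measure.map (Point.interior e) (Measure.comap Subtype.val (volume : Measure ℝ))

variable [Fintype V] [Fintype E] [DecidableEq V] [DecidableEq E]

/-- `ε = ∬ r(x, y) δ_K(x) μ_ad(y)`, where `K = ∑ p, (v(p) - 2) p`. -/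
def epsilonInv (G : MetrizedGraph V E) : ℝ :=
  ∑ p : V, ((G.valence p : ℝ) - 2) * ∫ y, G.resistance (.vertex p) y ∂G.admissibleMeasure

/-- `Z = (1 / 2) ∬ r(x, y) μ_ad(x) μ_ad(y)`. -/
def zInv (G : MetrizedGraph V E) : ℝ :=
  1 / 2 * ∫ x, ∫ y, G.resistance x y ∂G.admissibleMeasure ∂G.admissibleMeasure

/-- `φ = 3 g Z - (ε + ℓ) / 4`. -/
def phiInv (G : MetrizedGraph V E) : ℝ :=
  3 * G.genus * G.zInv - (G.epsilonInv + G.totalLength) / 4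

/-- `λ = (g - 1) / (6 (2 g + 1)) φ + (ε + ℓ) / 12`. -/
def lambdaInv (G : MetrizedGraph V E) : ℝ :=
  (G.genus - 1) / (6 * (2 * G.genus + 1)) * G.phiInv + (G.epsilonInv + G.totalLength) / 12

end MetrizedGraph

/-- The ladder graph `L_n` with `n` rungs, for `n ≥ 1`, all edges of length one. The vertices are
`(i, false)` (on one rail) and `(i, true)` (on the other), for `i < n`. The edges are the `n` rungs
`inl i`, joining `(i, false)` and `(i, true)`, and the `2 (n - 1)` rail edges `inr (j, s)`, joining
`(j, s)` and `(j + 1, s)` for `j < n - 1`. -/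
def ladder (n : ℕ) : MetrizedGraph (Fin n × Bool) (Fin n ⊕ Fin (n - 1) × Bool) where
  src
    | .inl i => (i, false)
    | .inr (j, s) => (⟨j, by omega⟩, s)
  tgt
    | .inl i => (i, true)
    | .inr (j, s) => (⟨j + 1, by omega⟩, s)
  len _ := 1
  len_pos _ := one_pos

end

/-!
The four invariants are integrals of the effective resistance, and everything is computed from a
Green kernel `K` of the discrete Laplacian on the vertices (`IsGreenKernel`). Interpolating `K`
linearly along the edges and adding the Green function of the segment (`EnergyFunction.tent`) gives
the potential of a unit current entering at an arbitrary point, hence the resistance between any two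
points (`IsGreenKernel.resistance_eq`). A voltage for the end points of an edge `e`, restricted to
the other edges and rescaled, is a unit voltage in the graph without `e`; this gives
`1 / (1 + R_e) = 1 - r(a, b)` for an edge of length one with end points `a`, `b`. On each edge the
resistance is then an explicit function of the parameters, and integration reduces `ε` and `Z` to
finite sums of resistances between vertices (`IsGreenKernel.epsilonInv_eq`,
`IsGreenKernel.zInv_eq`).

For the ladder, exchanging the rails splits functions into an even part, where the Laplacian is that
of a path, and an odd part, where it is `-Δ + 2` on a path with reflecting ends. The Green function
of the latter is a sum of two hyperbolic cosines by the method of images, with `cosh θ = 2`, that is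
`exp (-θ) = 2 - √3` (`isGreenKernel_ladderKernel`). Writing `E i` for the image term at the rung
`i`, the canonical measure gives both vertices of the rung the weight `1 / 2 - 3 E i`
(`sum_edgeDensity_mul_ladder`); there is no exception at the four corners, because the expression
for the density of the rail edges vanishes just beyond both ends. The remaining sums of `E i`, `E i ^ 2`
and `|i - j| * E j` telescope, since `E` is an eigenfunction of the second difference. They are
polynomials in the number of rungs and in `t = coth (n θ) / (2 √3)`, and the terms in `t ^ 2`
cancel.
-/

noncomputable section

namespace MetrizedGraph

variable {V E : Type} {G : MetrizedGraph V E}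

/-! ### Functions of finite energy -/

namespace EnergyFunction

lemma slope_intervalIntegrable (f : G.EnergyFunction) (e : E) :
    IntervalIntegrable (f.slope e) volume 0 (G.len e) := by
  rw [intervalIntegrable_iff_integrableOn_Ioo_of_le (G.len_pos e).le]
  exact (f.slope_memLp e).integrable one_le_two

lemma slope_intervalIntegrable_of_mem (f : G.EnergyFunction) (e : E) {t : ℝ}
    (ht : t ∈ Icc 0 (G.len e)) : IntervalIntegrable (f.slope e) volume 0 t := by
  refine (f.slope_intervalIntegrable e).mono_set ?_
  rw [uIcc_of_le ht.1, uIcc_of_le (G.len_pos e).le]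
  exact Icc_subset_Icc_right ht.2

lemma slope_mul_intervalIntegrable (f h : G.EnergyFunction) (e : E) :
    IntervalIntegrable (fun t => f.slope e t * h.slope e t) volume 0 (G.len e) := by
  rw [intervalIntegrable_iff_integrableOn_Ioo_of_le (G.len_pos e).le]
  exact (f.slope_memLp e).integrable_mul (h.slope_memLp e)

/-- The energy function with given values at the vertices and given slopes; on an edge it is
recovered by integrating the slope from the source. -/
def ofSlope (u : V → ℝ) (σ : E → ℝ → ℝ)
    (hσ : ∀ e, MemLp (σ e) 2 (volume.restrict (Ioo 0 (G.len e))))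
    (hu : ∀ e, u (G.tgt e) = u (G.src e) + ∫ s in (0 : ℝ)..G.len e, σ e s) :
    G.EnergyFunction where
  toFun
    | .vertex v => u v
    | .interior e t => u (G.src e) + ∫ s in (0 : ℝ)..(t : ℝ), σ e s
  slope := σ
  slope_memLp := hσ
  value_interior _ _ := rfl
  value_tgt := hu

/-- The linear combination `a f + b h`. -/
def linComb (a b : ℝ) (f h : G.EnergyFunction) : G.EnergyFunction where
  toFun x := a * f.toFun x + b * h.toFun x
  slope e s := a * f.slope e s + b * h.slope e s
  slope_memLp e := ((f.slope_memLp e).const_mul a).add ((h.slope_memLp e).const_mul b)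
  value_interior e t := by
    have ht : (t : ℝ) ∈ Icc 0 (G.len e) := Ioo_subset_Icc_self t.2
    rw [intervalIntegral.integral_add ((f.slope_intervalIntegrable_of_mem e ht).const_mul a)
      ((h.slope_intervalIntegrable_of_mem e ht).const_mul b), f.value_interior, h.value_interior,
      intervalIntegral.integral_const_mul, intervalIntegral.integral_const_mul]
    ring
  value_tgt e := by
    rw [intervalIntegral.integral_add ((f.slope_intervalIntegrable e).const_mul a)
      ((h.slope_intervalIntegrable e).const_mul b), f.value_tgt, h.value_tgt,
      intervalIntegral.integral_const_mul, intervalIntegral.integral_const_mul]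
    ring

/-- The function with given values at the vertices that is affine on each edge. -/
def affine (G : MetrizedGraph V E) (u : V → ℝ) : G.EnergyFunction :=
  ofSlope u (fun e _ => (u (G.tgt e) - u (G.src e)) / G.len e) (fun _ => memLp_const _) fun e => by
    have := (G.len_pos e).ne'
    rw [intervalIntegral.integral_const, smul_eq_mul]
    field_simp
    ring

lemma affine_vertex (u : V → ℝ) (v : V) : (affine G u).toFun (.vertex v) = u v := rfl

lemma affine_interior (u : V → ℝ) (e : E) (t : Ioo (0 : ℝ) (G.len e)) :
    (affine G u).toFun (.interior e t) =
      (1 - t / G.len e) * u (G.src e) + t / G.len e * u (G.tgt e) := by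
  have h := (affine G u).value_interior e t
  have h' : ∀ s, (affine G u).slope e s = (u (G.tgt e) - u (G.src e)) / G.len e := fun _ => rfl
  simp only [h', intervalIntegral.integral_const, smul_eq_mul, affine_vertex] at h
  rw [h]
  ring

lemma intervalIntegral_indicator_Iio_mul {f : ℝ → ℝ} {t L : ℝ} (h0 : 0 ≤ t) (hL : t ≤ L) :
    ∫ s in (0 : ℝ)..L, (Iio t).indicator (fun _ => (1 : ℝ)) s * f s = ∫ s in (0 : ℝ)..t, f s := by
  rw [intervalIntegral.integral_of_le (h0.trans hL), intervalIntegral.integral_of_le h0,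
    integral_Ioc_eq_integral_Ioo, integral_Ioc_eq_integral_Ioo]
  have : (fun s => (Iio t).indicator (fun _ => (1 : ℝ)) s * f s) = (Iio t).indicator f := by
    ext s
    by_cases hs : s ∈ Iio t <;> simp [hs]
  rw [this, setIntegral_indicator measurableSet_Iio, Ioo_inter_Iio, min_eq_right hL]

lemma intervalIntegral_indicator_Iio {t y : ℝ} (h0 : 0 ≤ t) (hy : 0 ≤ y) :
    ∫ s in (0 : ℝ)..y, (Iio t).indicator (fun _ => (1 : ℝ)) s = min y t := by
  rw [intervalIntegral.integral_of_le hy, integral_Ioc_eq_integral_Ioo,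
    setIntegral_indicator measurableSet_Iio, Ioo_inter_Iio]
  simp [h0, hy]

lemma memLp_indicator_Iio (t L : ℝ) :
    MemLp ((Iio t).indicator fun _ => (1 : ℝ)) 2 (volume.restrict (Ioo 0 L)) :=
  (memLp_const 1).indicator measurableSet_Iio

variable [DecidableEq E]

/-- The Green function of the edge `e₀` with pole at `t` and zero boundary values, extended by zero
to the other edges: it rises with slope `1 - t / L` up to `t`, then falls with slope `-t / L`. -/
def tent (e₀ : E) (t : Ioo (0 : ℝ) (G.len e₀)) : G.EnergyFunction :=
  ofSlope 0
    (fun e s => if e = e₀ then (Iio (t : ℝ)).indicator (fun _ => (1 : ℝ)) s - t / G.len e₀ else 0)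
    (fun e => by
      split_ifs
      · exact (memLp_indicator_Iio _ _).sub (memLp_const _)
      · exact memLp_const 0)
    fun e => by
      split_ifs with h
      · subst h
        have := (G.len_pos e).ne'
        rw [intervalIntegral.integral_sub, intervalIntegral_indicator_Iio t.2.1.le (G.len_pos e).le,
          min_eq_right t.2.2.le]
        · simp
          field_simp
          ring
        · rw [intervalIntegrable_iff_integrableOn_Ioo_of_le (G.len_pos e).le]
          exact (memLp_indicator_Iio _ _).integrable one_le_two
        · simp
      · simp

lemma tent_vertex (e₀ : E) (t : Ioo (0 : ℝ) (G.len e₀)) (v : V) :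
    (tent e₀ t).toFun (.vertex v) = 0 := rfl

lemma tent_interior (e₀ : E) (t : Ioo (0 : ℝ) (G.len e₀)) (e : E) (s : Ioo (0 : ℝ) (G.len e)) :
    (tent e₀ t).toFun (.interior e s) =
      if e = e₀ then min (s : ℝ) t - s * t / G.len e₀ else 0 := by
  have h := (tent e₀ t).value_interior e s
  have h' : (tent e₀ t).slope e = fun s =>
    if e = e₀ then (Iio (t : ℝ)).indicator (fun _ => (1 : ℝ)) s - t / G.len e₀ else 0 := rfl
  rw [h, h', tent_vertex]
  split_ifs with h
  · subst h
    rw [intervalIntegral.integral_sub, intervalIntegral_indicator_Iio t.2.1.le s.2.1.le]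
    · simp
    · rw [intervalIntegrable_iff_integrableOn_Ioo_of_le s.2.1.le]
      exact (memLp_indicator_Iio _ _).integrable one_le_two
    · simp
  · simp

end EnergyFunction

open EnergyFunction

variable [Fintype E]

lemma dirichlet_comm (f h : G.EnergyFunction) : G.dirichlet f h = G.dirichlet h f := by
  simp only [dirichlet, mul_comm]

lemma dirichlet_self_nonneg (f : G.EnergyFunction) : 0 ≤ G.dirichlet f f :=
  Finset.sum_nonneg fun e _ =>
    intervalIntegral.integral_nonneg (G.len_pos e).le fun _ _ => mul_self_nonneg _

lemma dirichlet_linComb_left (a b : ℝ) (f₁ f₂ h : G.EnergyFunction) :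
    G.dirichlet (linComb a b f₁ f₂) h = a * G.dirichlet f₁ h + b * G.dirichlet f₂ h := by
  simp only [dirichlet, Finset.mul_sum, ← Finset.sum_add_distrib]
  refine Finset.sum_congr rfl fun e _ => ?_
  rw [← intervalIntegral.integral_const_mul, ← intervalIntegral.integral_const_mul,
    ← intervalIntegral.integral_add ((f₁.slope_mul_intervalIntegrable h e).const_mul a)
      ((f₂.slope_mul_intervalIntegrable h e).const_mul b)]
  refine intervalIntegral.integral_congr fun t _ => ?_
  simp only [linComb]
  ring

lemma dirichlet_affine_left (u : V → ℝ) (h : G.EnergyFunction) :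
    G.dirichlet (affine G u) h = ∑ e, (u (G.tgt e) - u (G.src e)) *
      (h.toFun (.vertex (G.tgt e)) - h.toFun (.vertex (G.src e))) / G.len e := by
  refine Finset.sum_congr rfl fun e _ => ?_
  have h' : ∀ s, (affine G u).slope e s = (u (G.tgt e) - u (G.src e)) / G.len e := fun _ => rfl
  simp only [h', intervalIntegral.integral_const_mul, h.value_tgt e]
  ring

lemma dirichlet_tent_left [DecidableEq E] (e : E) (t : Ioo (0 : ℝ) (G.len e))
    (h : G.EnergyFunction) :
    G.dirichlet (tent e t) h = h.toFun (.interior e t) -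
      ((1 - t / G.len e) * h.toFun (.vertex (G.src e)) +
        t / G.len e * h.toFun (.vertex (G.tgt e))) := by
  have h' : ∀ e', (tent e t).slope e' = fun s =>
    if e' = e then (Iio (t : ℝ)).indicator (fun _ => (1 : ℝ)) s - t / G.len e else 0 :=
    fun _ => rfl
  rw [dirichlet, Finset.sum_eq_single e]
  · simp only [h', if_true, sub_mul]
    have hi := h.slope_intervalIntegrable e
    rw [intervalIntegral.integral_sub, intervalIntegral_indicator_Iio_mul t.2.1.le t.2.2.le,
      intervalIntegral.integral_const_mul, h.value_interior, h.value_tgt]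
    · ring
    · rw [intervalIntegrable_iff_integrableOn_Ioo_of_le (G.len_pos e).le]
      exact (memLp_indicator_Iio _ _).integrable_mul (h.slope_memLp e)
    · exact hi.const_mul _
  · intro e' _ he'
    simp [h', he']
  · simp

/-! ### Effective resistance -/

/-- All unit voltages from `x` to `y` have the same drop, by symmetry of the Dirichlet form. -/
lemma IsUnitVoltage.drop_eq {x y : G.Point} {f f' : G.EnergyFunction}
    (hf : G.IsUnitVoltage x y f) (hf' : G.IsUnitVoltage x y f') :
    f.toFun x - f.toFun y = f'.toFun x - f'.toFun y := by
  rw [← hf' f, ← hf f', dirichlet_comm]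

lemma IsUnitVoltage.eResistance_eq {x y : G.Point} {f : G.EnergyFunction}
    (hf : G.IsUnitVoltage x y f) :
    G.eResistance x y = ENNReal.ofReal (f.toFun x - f.toFun y) :=
  le_antisymm (iInf₂_le f hf) (le_iInf₂ fun _ hf' => by rw [hf.drop_eq hf'])

lemma IsUnitVoltage.drop_nonneg {x y : G.Point} {f : G.EnergyFunction}
    (hf : G.IsUnitVoltage x y f) : 0 ≤ f.toFun x - f.toFun y :=
  hf f ▸ dirichlet_self_nonneg f

lemma IsUnitVoltage.resistance_eq {x y : G.Point} {f : G.EnergyFunction}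
    (hf : G.IsUnitVoltage x y f) : G.resistance x y = f.toFun x - f.toFun y := by
  rw [resistance, hf.eResistance_eq, ENNReal.toReal_ofReal hf.drop_nonneg]

/-- `K` is a symmetric Green kernel for the discrete Laplacian on the vertices: `K p` is a potential
of the unit current that enters at `p` and leaves through the vertices according to the
distribution `ρ`, which does not depend on `p`. The Laplacian appears in weak form. -/
structure IsGreenKernel [Fintype V] (G : MetrizedGraph V E) (K : V → V → ℝ) (ρ : V → ℝ) :
    Prop where
  symm : ∀ p q, K p q = K q p
  sum_eq : ∀ (p : V) (h : V → ℝ),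
    ∑ e, (K p (G.tgt e) - K p (G.src e)) * (h (G.tgt e) - h (G.src e)) / G.len e =
      h p - ∑ v, ρ v * h v

/-- The resistance between two vertices, in terms of a Green kernel. -/
def kernelResistance (K : V → V → ℝ) (p q : V) : ℝ := K p p + K q q - 2 * K p q

section GreenKernel

variable [DecidableEq E]

/-- The extension of a Green kernel from the vertices to the points of the metrized graph: linear
interpolation between the end points of an edge, plus the Green function of the edge. -/
def potential (K : V → V → ℝ) : G.Point → G.EnergyFunction
  | .vertex p => affine G (K p)
  | .interior e t => linComb 1 1
      (affine G fun q => (1 - t / G.len e) * K (G.src e) q + t / G.len e * K (G.tgt e) q) (tent e t)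

variable [Fintype V] {K : V → V → ℝ} {ρ : V → ℝ}

lemma IsGreenKernel.dirichlet_potential (hK : G.IsGreenKernel K ρ) (x : G.Point)
    (h : G.EnergyFunction) :
    G.dirichlet (potential K x) h = h.toFun x - ∑ v, ρ v * h.toFun (.vertex v) := by
  cases x with
  | vertex p => rw [potential, dirichlet_affine_left, hK.sum_eq p fun v => h.toFun (.vertex v)]
  | interior e t =>
    have h1 := hK.sum_eq (G.src e) fun v => h.toFun (.vertex v)
    have h2 := hK.sum_eq (G.tgt e) fun v => h.toFun (.vertex v)
    have key : ∑ e', (((1 - t / G.len e) * K (G.src e) (G.tgt e') +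
          t / G.len e * K (G.tgt e) (G.tgt e')) - ((1 - t / G.len e) * K (G.src e) (G.src e') +
          t / G.len e * K (G.tgt e) (G.src e'))) *
        (h.toFun (.vertex (G.tgt e')) - h.toFun (.vertex (G.src e'))) / G.len e' =
        (1 - t / G.len e) * (h.toFun (.vertex (G.src e)) - ∑ v, ρ v * h.toFun (.vertex v)) +
        t / G.len e * (h.toFun (.vertex (G.tgt e)) - ∑ v, ρ v * h.toFun (.vertex v)) := by
      rw [← h1, ← h2, Finset.mul_sum, Finset.mul_sum, ← Finset.sum_add_distrib]
      exact Finset.sum_congr rfl fun _ _ => by ring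
    rw [potential, dirichlet_linComb_left, dirichlet_affine_left, dirichlet_tent_left, key]
    ring

lemma IsGreenKernel.isUnitVoltage (hK : G.IsGreenKernel K ρ) (x y : G.Point) :
    G.IsUnitVoltage x y (linComb 1 (-1) (potential K x) (potential K y)) := fun h => by
  rw [dirichlet_linComb_left, hK.dirichlet_potential, hK.dirichlet_potential]
  ring

lemma IsGreenKernel.resistance_eq (hK : G.IsGreenKernel K ρ) (x y : G.Point) :
    G.resistance x y = (potential K x).toFun x - (potential K y).toFun x -
      (potential K x).toFun y + (potential K y).toFun y := by
  rw [(hK.isUnitVoltage x y).resistance_eq]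
  simp only [linComb]
  ring

/-- The voltage for the end points of `e` leaves the current `1 - R / L` to the other edges, so its
rescaling is the unit voltage in the graph without `e`. -/
lemma IsGreenKernel.deletedResistance_eq (hK : G.IsGreenKernel K ρ) (e : E)
    (he : kernelResistance K (G.src e) (G.tgt e) < G.len e) :
    G.deletedResistance e = ENNReal.ofReal (kernelResistance K (G.src e) (G.tgt e) /
      (1 - kernelResistance K (G.src e) (G.tgt e) / G.len e)) := by
  set R := kernelResistance K (G.src e) (G.tgt e) with hR
  have hL := G.len_pos e
  have hc : 1 - R / G.len e ≠ 0 := by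
    rw [sub_ne_zero, ne_comm, Ne, div_eq_one_iff_eq hL.ne']
    exact he.ne
  have hv : (G.deleteEdge e).IsUnitVoltage (.vertex (G.src e)) (.vertex (G.tgt e))
      (affine _ fun q => (K (G.src e) q - K (G.tgt e) q) / (1 - R / G.len e)) := by
    intro h
    rw [dirichlet_affine_left]
    have h1 := hK.sum_eq (G.src e) fun v => h.toFun (.vertex v)
    have h2 := hK.sum_eq (G.tgt e) fun v => h.toFun (.vertex v)
    rw [Fintype.sum_eq_add_sum_subtype_ne _ e] at h1 h2
    have h3 : ∀ S₁ S₂ S₃ : ℝ, S₃ = (S₁ - S₂) / (1 - R / G.len e) →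
        (K (G.src e) (G.tgt e) - K (G.src e) (G.src e)) *
          (h.toFun (.vertex (G.tgt e)) - h.toFun (.vertex (G.src e))) / G.len e + S₁ =
          h.toFun (.vertex (G.src e)) - ∑ v, ρ v * h.toFun (.vertex v) →
        (K (G.tgt e) (G.tgt e) - K (G.tgt e) (G.src e)) *
          (h.toFun (.vertex (G.tgt e)) - h.toFun (.vertex (G.src e))) / G.len e + S₂ =
          h.toFun (.vertex (G.tgt e)) - ∑ v, ρ v * h.toFun (.vertex v) →
        S₃ = h.toFun (.vertex (G.src e)) - h.toFun (.vertex (G.tgt e)) := by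
      intro S₁ S₂ S₃ h₃ h₁ h₂
      rw [h₃, div_eq_iff hc, hR, kernelResistance]
      rw [hK.symm (G.tgt e) (G.src e)] at h₂
      linear_combination h₁ - h₂
    refine h3 _ _ _ ?_ h1 h2
    rw [← Finset.sum_sub_distrib, Finset.sum_div]
    refine Finset.sum_congr rfl fun e' _ => ?_
    simp only [deleteEdge]
    ring
  rw [deletedResistance, hv.eResistance_eq, affine_vertex, affine_vertex, ← sub_div]
  congr 2
  rw [hR, kernelResistance, hK.symm (G.tgt e) (G.src e)]
  ring

end GreenKernel

end MetrizedGraph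

namespace MetrizedGraph

variable {V E : Type} {G : MetrizedGraph V E}

/-- Double counting of the pairs of an edge and one of its ends. -/
lemma sum_valence_mul [Fintype V] [Fintype E] [DecidableEq V] (u : V → ℝ) :
    ∑ p, (G.valence p : ℝ) * u p = ∑ e, (u (G.src e) + u (G.tgt e)) := by
  have h (φ : E → V) : ∑ p, ((Finset.univ.filter fun e => φ e = p).card : ℝ) * u p =
      ∑ e, u (φ e) := by
    rw [← Finset.sum_fiberwise (g := φ)]
    refine Finset.sum_congr rfl fun p _ => ?_
    rw [Finset.sum_congr rfl (g := fun _ => u p), Finset.sum_const, nsmul_eq_mul]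
    intro e he
    rw [(Finset.mem_filter.1 he).2]
  simp only [valence, Nat.cast_add, add_mul, Finset.sum_add_distrib, h]

/-! ### Integration against the admissible measure -/

lemma measurable_interior (e : E) : Measurable (Point.interior e : _ → G.Point) :=
  fun _ hs => MeasurableSpace.measurableSet_iInf.1 hs e

lemma measurable_of_interior {f : G.Point → ℝ}
    (hf : ∀ e, Measurable fun t : Ioo (0 : ℝ) (G.len e) => f (.interior e t)) : Measurable f :=
  fun _ hs => MeasurableSpace.measurableSet_iInf.2 fun e => hf e hs

variable [Fintype V] [Fintype E] [DecidableEq E]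

/-- On each edge, `f` is assumed to be the restriction of a continuous function `F e` of the
parameter. -/
lemma integral_admissibleMeasure (hg : 0 ≤ G.genus) {f : G.Point → ℝ} {F : E → ℝ → ℝ} {c : E → ℝ}
    (hF : ∀ e, Continuous (F e)) (hf : ∀ e t, f (.interior e t) = F e t)
    (hc0 : ∀ e, 0 ≤ c e)
    (hc : ∀ e, (ENNReal.ofReal (G.len e) + G.deletedResistance e)⁻¹ = ENNReal.ofReal (c e)) :
    ∫ y, f y ∂G.admissibleMeasure =
      G.genus⁻¹ * ∑ e, c e * ∫ t in (0 : ℝ)..G.len e, F e t := by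
  have hmeas : Measurable f := measurable_of_interior fun e => by
    simp only [hf]
    exact (hF e).measurable.comp measurable_subtype_coe
  have hemb (e : E) : MeasurableEmbedding (Subtype.val : Ioo (0 : ℝ) (G.len e) → ℝ) :=
    MeasurableEmbedding.subtype_coe measurableSet_Ioo
  have hint (e : E) : Integrable f
      (Measure.map (Point.interior e) (Measure.comap Subtype.val (volume : Measure ℝ))) := by
    rw [integrable_map_measure hmeas.aestronglyMeasurable (measurable_interior e).aemeasurable]
    have : IntegrableOn (F e) (Ioo 0 (G.len e)) volume :=
      ((hF e).integrableOn_Icc).mono_set Ioo_subset_Icc_self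
    rw [IntegrableOn, ← map_comap_subtype_coe measurableSet_Ioo,
      (hemb e).integrable_map_iff] at this
    exact this.congr (Filter.Eventually.of_forall fun t => (hf e t).symm)
  rw [admissibleMeasure, integral_smul_measure, integral_finsetSum_measure, ENNReal.toReal_inv,
    ENNReal.toReal_ofReal hg, smul_eq_mul]
  · congr 1
    refine Finset.sum_congr rfl fun e _ => ?_
    rw [hc, integral_smul_measure, ENNReal.toReal_ofReal (hc0 e), smul_eq_mul,
      integral_map (measurable_interior e).aemeasurable hmeas.aestronglyMeasurable]
    simp only [hf]
    rw [integral_subtype_comap measurableSet_Ioo, intervalIntegral.integral_of_le (G.len_pos e).le,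
      integral_Ioc_eq_integral_Ioo]
  · intro e _
    refine (hint e).smul_measure ?_
    rw [hc]
    exact ENNReal.ofReal_ne_top

/-! ### The invariants of a graph with edges of length one -/

lemma integral_interpolation (a b c : ℝ) :
    ∫ t in (0 : ℝ)..1, ((1 - t) * a + t * b + c * (t * (1 - t))) = (a + b) / 2 + c / 6 := by
  have h : ∀ t ∈ uIcc (0 : ℝ) 1, HasDerivAt
      (fun t : ℝ => (t - t ^ 2 / 2) * a + t ^ 2 / 2 * b + c * (t ^ 2 / 2 - t ^ 3 / 3))
      ((1 - t) * a + t * b + c * (t * (1 - t))) t := by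
    intro t _
    have h2 : HasDerivAt (fun t : ℝ => t ^ 2 / 2) t t := by
      simpa using (hasDerivAt_pow 2 t).div_const 2
    have h3 : HasDerivAt (fun t : ℝ => t ^ 3 / 3) (t ^ 2) t := by
      simpa using (hasDerivAt_pow 3 t).div_const 3
    exact (((((hasDerivAt_id' t).sub h2).mul_const a).add (h2.mul_const b)).add
      ((h2.sub h3).const_mul c)).congr_deriv (by ring)
  rw [intervalIntegral.integral_eq_sub_of_hasDerivAt h
    (Continuous.intervalIntegrable (by fun_prop) _ _)]
  norm_num
  ring

lemma integral_min_sub_mul {s : ℝ} (h0 : 0 ≤ s) (h1 : s ≤ 1) :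
    ∫ t in (0 : ℝ)..1, (min t s - t * s) = s * (1 - s) / 2 := by
  have hmin (a b : ℝ) : IntervalIntegrable (fun t => min t s) volume a b :=
    Continuous.intervalIntegrable (by fun_prop) _ _
  rw [intervalIntegral.integral_sub (hmin _ _) (Continuous.intervalIntegrable (by fun_prop) _ _),
    ← intervalIntegral.integral_add_adjacent_intervals (hmin 0 s) (hmin s 1),
    intervalIntegral.integral_congr (g := fun t => t), intervalIntegral.integral_congr
      (g := fun _ => s) (a := s)]
  · simp
    ring
  · intro t ht
    rw [uIcc_of_le h1] at ht
    exact min_eq_right ht.1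
  · intro t ht
    rw [uIcc_of_le h0] at ht
    exact min_eq_left ht.2

open EnergyFunction

variable {K : V → V → ℝ} {ρ : V → ℝ}

/-- The density `1 / (1 + R_e) = 1 - r(a, b)` of the canonical measure on the edge `e`, where `a`
and `b` are its end points. The formula presupposes that the edge has length one. -/
def edgeDensity (G : MetrizedGraph V E) (K : V → V → ℝ) (e : E) : ℝ :=
  1 - kernelResistance K (G.src e) (G.tgt e)

/-- The integral of `r(v, ·)` against the canonical measure `∑ e, dy / (1 + R_e)`, which is the
genus times the admissible measure. -/
def resistanceMean (G : MetrizedGraph V E) (K : V → V → ℝ) (v : V) : ℝ :=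
  ∑ e, edgeDensity G K e * ((kernelResistance K v (G.src e) + kernelResistance K v (G.tgt e)) / 2 +
    edgeDensity G K e / 6)

lemma IsGreenKernel.resistance_vertex_interior (hK : G.IsGreenKernel K ρ)
    (hlen : ∀ e, G.len e = 1) (v : V) (e : E) (t : Ioo (0 : ℝ) (G.len e)) :
    G.resistance (.vertex v) (.interior e t) =
      (1 - t) * kernelResistance K v (G.src e) + t * kernelResistance K v (G.tgt e) +
        edgeDensity G K e * (t * (1 - t)) := by
  rw [hK.resistance_eq]
  simp only [potential, linComb, affine_vertex, affine_interior, tent_vertex, tent_interior,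
    edgeDensity, kernelResistance, hlen, div_one, if_true, min_self]
  rw [hK.symm (G.src e) v, hK.symm (G.tgt e) v, hK.symm (G.tgt e) (G.src e)]
  ring

/-- The resistance is biaffine up to a quadratic correction for each of the two points; on a common
edge the Green function of the edge enters once more. -/
lemma IsGreenKernel.resistance_interior_interior (hK : G.IsGreenKernel K ρ)
    (hlen : ∀ e, G.len e = 1) (e e' : E) (s : Ioo (0 : ℝ) (G.len e)) (t : Ioo (0 : ℝ) (G.len e')) :
    G.resistance (.interior e s) (.interior e' t) =
      ((1 - t) * ((1 - s) * kernelResistance K (G.src e) (G.src e') +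
          s * kernelResistance K (G.tgt e) (G.src e') + edgeDensity G K e * (s * (1 - s))) +
        t * ((1 - s) * kernelResistance K (G.src e) (G.tgt e') +
          s * kernelResistance K (G.tgt e) (G.tgt e') + edgeDensity G K e * (s * (1 - s))) +
        edgeDensity G K e' * (t * (1 - t))) -
      if e' = e then 2 * (min (t : ℝ) s - t * s) else 0 := by
  rw [hK.resistance_eq]
  simp only [potential, linComb, affine_interior, tent_interior,
    edgeDensity, kernelResistance, hlen, div_one, if_true, min_self]
  rw [hK.symm (G.src e') (G.src e), hK.symm (G.src e') (G.tgt e), hK.symm (G.tgt e') (G.src e),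
    hK.symm (G.tgt e') (G.tgt e), hK.symm (G.tgt e) (G.src e), hK.symm (G.tgt e') (G.src e')]
  by_cases h : e' = e
  · simp only [h, if_true, min_comm (s : ℝ) t]
    ring
  · simp only [h, Ne.symm h, if_false]
    ring

lemma IsGreenKernel.inv_add_deletedResistance (hK : G.IsGreenKernel K ρ)
    (hlen : ∀ e, G.len e = 1) {e : E} (he : 0 < edgeDensity G K e) :
    (ENNReal.ofReal (G.len e) + G.deletedResistance e)⁻¹ = ENNReal.ofReal (edgeDensity G K e) := by
  have hR : 0 ≤ kernelResistance K (G.src e) (G.tgt e) := by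
    have h := (hK.isUnitVoltage (.vertex (G.src e)) (.vertex (G.tgt e))).drop_nonneg
    simp only [linComb, potential, affine_vertex] at h
    rw [hK.symm (G.tgt e) (G.src e)] at h
    rw [kernelResistance]
    linarith
  rw [edgeDensity] at *
  set R := kernelResistance K (G.src e) (G.tgt e)
  rw [hK.deletedResistance_eq e (by rw [hlen]; linarith), hlen, div_one,
    ← ENNReal.ofReal_add zero_le_one (div_nonneg hR he.le), ← ENNReal.ofReal_inv_of_pos]
  · congr 1
    have := he.ne'
    field_simp
    simp
  · exact add_pos_of_pos_of_nonneg one_pos (div_nonneg hR he.le)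

lemma IsGreenKernel.integral_resistance_vertex (hK : G.IsGreenKernel K ρ)
    (hlen : ∀ e, G.len e = 1) (hg : 0 ≤ G.genus) (hc : ∀ e, 0 < edgeDensity G K e) (v : V) :
    ∫ y, G.resistance (.vertex v) y ∂G.admissibleMeasure =
      G.genus⁻¹ * resistanceMean G K v := by
  rw [integral_admissibleMeasure hg (F := fun e t => (1 - t) * kernelResistance K v (G.src e) +
    t * kernelResistance K v (G.tgt e) + edgeDensity G K e * (t * (1 - t)))
    (fun e => by fun_prop) (fun e t => hK.resistance_vertex_interior hlen v e t)
    (fun e => (hc e).le) fun e => hK.inv_add_deletedResistance hlen (hc e)]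
  simp only [hlen, integral_interpolation, resistanceMean]

lemma IsGreenKernel.integral_resistance_interior (hK : G.IsGreenKernel K ρ)
    (hlen : ∀ e, G.len e = 1) (hg : 0 ≤ G.genus) (hc : ∀ e, 0 < edgeDensity G K e) (e : E)
    (s : Ioo (0 : ℝ) (G.len e)) :
    ∫ y, G.resistance (.interior e s) y ∂G.admissibleMeasure =
      (1 - s) * (G.genus⁻¹ * resistanceMean G K (G.src e)) +
        s * (G.genus⁻¹ * resistanceMean G K (G.tgt e)) +
        G.genus⁻¹ * (edgeDensity G K e * (∑ e', edgeDensity G K e' - 1)) * (s * (1 - s)) := by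
  have hs1 : (s : ℝ) ≤ 1 := by simpa [hlen] using s.2.2.le
  rw [integral_admissibleMeasure hg (F := fun e' t =>
      ((1 - t) * ((1 - s) * kernelResistance K (G.src e) (G.src e') +
          s * kernelResistance K (G.tgt e) (G.src e') + edgeDensity G K e * (s * (1 - s))) +
        t * ((1 - s) * kernelResistance K (G.src e) (G.tgt e') +
          s * kernelResistance K (G.tgt e) (G.tgt e') + edgeDensity G K e * (s * (1 - s))) +
        edgeDensity G K e' * (t * (1 - t))) -
      if e' = e then 2 * (min (t : ℝ) s - t * s) else 0)
    (fun e' => by split_ifs <;> fun_prop)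
    (fun e' t => hK.resistance_interior_interior hlen e e' s t)
    (fun e => (hc e).le) fun e => hK.inv_add_deletedResistance hlen (hc e)]
  have h1 : ∀ e', ∫ t in (0 : ℝ)..1,
      (((1 - t) * ((1 - (s : ℝ)) * kernelResistance K (G.src e) (G.src e') +
          s * kernelResistance K (G.tgt e) (G.src e') + edgeDensity G K e * (s * (1 - (s : ℝ)))) +
        t * ((1 - (s : ℝ)) * kernelResistance K (G.src e) (G.tgt e') +
          s * kernelResistance K (G.tgt e) (G.tgt e') + edgeDensity G K e * (s * (1 - (s : ℝ)))) +
        edgeDensity G K e' * (t * (1 - t))) -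
      if e' = e then 2 * (min (t : ℝ) s - t * s) else 0) =
      ((1 - (s : ℝ)) * ((kernelResistance K (G.src e) (G.src e') +
          kernelResistance K (G.src e) (G.tgt e')) / 2 + edgeDensity G K e' / 6) +
        s * ((kernelResistance K (G.tgt e) (G.src e') +
          kernelResistance K (G.tgt e) (G.tgt e')) / 2 + edgeDensity G K e' / 6) +
        edgeDensity G K e * (s * (1 - (s : ℝ)))) -
          if e' = e then s * (1 - (s : ℝ)) else (0 : ℝ) := by
    intro e'
    rw [intervalIntegral.integral_sub (Continuous.intervalIntegrable (by fun_prop) _ _)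
      (Continuous.intervalIntegrable (by split_ifs <;> fun_prop) _ _), integral_interpolation]
    congr 1
    · ring
    · split_ifs
      · rw [intervalIntegral.integral_const_mul, integral_min_sub_mul s.2.1.le hs1]
        ring
      · simp
  -- Only the edge of the point itself contributes the Green function of the segment.
  have h2 : ∑ e', edgeDensity G K e' * (if e' = e then (s : ℝ) * (1 - s) else 0) =
      edgeDensity G K e * (s * (1 - s)) := by simp
  simp only [hlen, h1, mul_sub (edgeDensity G K _) _ (ite _ _ _), Finset.sum_sub_distrib, h2]
  have h3 : ∀ A B C D : ℝ, D = (1 - s) * A + s * B + edgeDensity G K e * (s * (1 - s)) * C →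
      G.genus⁻¹ * (D - edgeDensity G K e * (s * (1 - s))) =
      (1 - s) * (G.genus⁻¹ * A) + s * (G.genus⁻¹ * B) +
        G.genus⁻¹ * (edgeDensity G K e * (C - 1)) * (s * (1 - s)) := by
    rintro A B C D rfl
    ring
  apply h3
  simp only [resistanceMean, Finset.mul_sum, ← Finset.sum_add_distrib]
  exact Finset.sum_congr rfl fun _ _ => by ring

lemma IsGreenKernel.zInv_eq [DecidableEq V] (hK : G.IsGreenKernel K ρ)
    (hlen : ∀ e, G.len e = 1) (hg : 0 ≤ G.genus) (hc : ∀ e, 0 < edgeDensity G K e) :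
    G.zInv = (∑ e, edgeDensity G K e *
      ((resistanceMean G K (G.src e) + resistanceMean G K (G.tgt e)) / 2 +
        edgeDensity G K e * (∑ e', edgeDensity G K e' - 1) / 6)) / (2 * G.genus ^ 2) := by
  rw [zInv, integral_admissibleMeasure hg (F := fun e s =>
      (1 - s) * (G.genus⁻¹ * resistanceMean G K (G.src e)) +
        s * (G.genus⁻¹ * resistanceMean G K (G.tgt e)) +
        G.genus⁻¹ * (edgeDensity G K e * (∑ e', edgeDensity G K e' - 1)) * (s * (1 - s)))
    (fun e => by fun_prop) (fun e s => hK.integral_resistance_interior hlen hg hc e s)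
    (fun e => (hc e).le) fun e => hK.inv_add_deletedResistance hlen (hc e)]
  simp only [hlen, integral_interpolation, Finset.mul_sum, Finset.sum_div]
  refine Finset.sum_congr rfl fun e _ => ?_
  ring

lemma IsGreenKernel.epsilonInv_eq [DecidableEq V] (hK : G.IsGreenKernel K ρ)
    (hlen : ∀ e, G.len e = 1) (hg : 0 ≤ G.genus) (hc : ∀ e, 0 < edgeDensity G K e) :
    G.epsilonInv = (∑ e, (resistanceMean G K (G.src e) + resistanceMean G K (G.tgt e)) -
      2 * ∑ p, resistanceMean G K p) / G.genus := by
  simp only [epsilonInv, hK.integral_resistance_vertex hlen hg hc]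
  rw [← sum_valence_mul, Finset.mul_sum, ← Finset.sum_sub_distrib, Finset.sum_div]
  exact Finset.sum_congr rfl fun _ _ => by ring

end MetrizedGraph

/-! ### Hyperbolic functions with `cosh θ = 2` -/

/-- The positive number `θ` with `exp (± θ) = 2 ± √3`, the roots of `x + x⁻¹ = 4`. -/
def ladderAngle : ℝ := Real.arsinh √3

lemma sinh_ladderAngle : Real.sinh ladderAngle = √3 := Real.sinh_arsinh _

lemma cosh_ladderAngle : Real.cosh ladderAngle = 2 := by
  rw [ladderAngle, Real.cosh_arsinh, Real.sq_sqrt (by norm_num), Real.sqrt_eq_iff_mul_self_eq] <;>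
    norm_num

lemma ladderAngle_pos : 0 < ladderAngle := Real.arsinh_pos_iff.2 (by positivity)

lemma exp_neg_ladderAngle : Real.exp (-ladderAngle) = 2 - √3 := by
  rw [← Real.cosh_sub_sinh, sinh_ladderAngle, cosh_ladderAngle]

/-- The solution `cosh (x θ) / (2 √3 sinh (N θ))` of the recurrence `E (x + 1) + E (x - 1) = 4 E x`;
it is normalized so that `E (N + 1) - E (N - 1) = 1`. -/
def coshRatio (N x : ℝ) : ℝ :=
  Real.cosh (x * ladderAngle) / (2 * √3 * Real.sinh (N * ladderAngle))

/-- The telescoping partner `sinh (x θ) / (12 sinh (N θ))` of `coshRatio`. -/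
def sinhRatio (N x : ℝ) : ℝ :=
  Real.sinh (x * ladderAngle) / (12 * Real.sinh (N * ladderAngle))

lemma sqrt_three_sq : √3 ^ 2 = (3 : ℝ) := Real.sq_sqrt (by norm_num)

lemma sinh_mul_ladderAngle_pos {x : ℝ} (hx : 0 < x) : 0 < Real.sinh (x * ladderAngle) :=
  Real.sinh_pos_iff.2 (mul_pos hx ladderAngle_pos)

lemma coshRatio_neg (N x : ℝ) : coshRatio N (-x) = coshRatio N x := by
  rw [coshRatio, neg_mul, Real.cosh_neg, coshRatio]

lemma coshRatio_add_one_add_sub_one (N x : ℝ) :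
    coshRatio N (x + 1) + coshRatio N (x - 1) = 4 * coshRatio N x := by
  simp only [coshRatio, add_mul, sub_mul, one_mul, Real.cosh_add, Real.cosh_sub, cosh_ladderAngle]
  ring

lemma coshRatio_self_sub_one {N : ℝ} (hN : 0 < N) :
    coshRatio N (N - 1) = 2 * coshRatio N N - 1 / 2 := by
  have := (sinh_mul_ladderAngle_pos hN).ne'
  simp only [coshRatio, sub_mul, one_mul, Real.cosh_sub, cosh_ladderAngle, sinh_ladderAngle]
  field_simp

lemma coshRatio_lt_self {N x : ℝ} (hx : |x| < N) : coshRatio N x < coshRatio N N := by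
  have hN : 0 < N := (abs_nonneg x).trans_lt hx
  have := sinh_mul_ladderAngle_pos hN
  have h3 : 0 < √(3 : ℝ) := by positivity
  rw [coshRatio, coshRatio, div_lt_div_iff_of_pos_right (by positivity), Real.cosh_lt_cosh, abs_mul,
    abs_mul, abs_of_pos hN]
  exact mul_lt_mul_of_pos_right hx (abs_pos.2 ladderAngle_pos.ne')

lemma coshRatio_le_sub_one {N x : ℝ} (hN : 1 ≤ N) (hx : |x| ≤ N - 1) :
    coshRatio N x ≤ coshRatio N (N - 1) := by
  have := sinh_mul_ladderAngle_pos (one_pos.trans_le hN)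
  rw [coshRatio, coshRatio]
  refine div_le_div_of_nonneg_right ?_ (by positivity)
  rw [Real.cosh_le_cosh, abs_mul, abs_mul, abs_of_nonneg (sub_nonneg.2 hN)]
  exact mul_le_mul_of_nonneg_right hx (abs_nonneg _)

lemma coshRatio_self_lt {N : ℝ} (hN : 1 < N) : coshRatio N N < 1 / 3 := by
  have h := sinh_mul_ladderAngle_pos (one_pos.trans hN)
  have h1 := sinh_mul_ladderAngle_pos (sub_pos.2 hN)
  have h3 : 0 < √(3 : ℝ) := by positivity
  rw [sub_mul, one_mul, Real.sinh_sub, cosh_ladderAngle, sinh_ladderAngle] at h1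
  rw [coshRatio, div_lt_div_iff₀ (by positivity) (by norm_num)]
  -- The claim is `0 < √3 * sinh ((N - 1) θ)`, expanded by the addition theorem.
  nlinarith [mul_pos h3 h1, sqrt_three_sq]

lemma sinhRatio_neg (N x : ℝ) : sinhRatio N (-x) = -sinhRatio N x := by
  rw [sinhRatio, neg_mul, Real.sinh_neg, sinhRatio, neg_div]

lemma sinhRatio_self {N : ℝ} (hN : 0 < N) : sinhRatio N N = 1 / 12 := by
  have := (sinh_mul_ladderAngle_pos hN).ne'
  rw [sinhRatio]
  field_simp

lemma sinhRatio_add_one_sub_sub_one (N x : ℝ) :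
    sinhRatio N (x + 1) - sinhRatio N (x - 1) = coshRatio N x := by
  have h3 : √(3 : ℝ) ≠ 0 := by positivity
  have hs := sqrt_three_sq
  rcases eq_or_ne (Real.sinh (N * ladderAngle)) 0 with h | h
  · simp [sinhRatio, coshRatio, h]
  simp only [sinhRatio, coshRatio, add_mul, sub_mul, one_mul, Real.sinh_add, Real.sinh_sub,
    sinh_ladderAngle]
  rw [← sub_div, div_eq_div_iff (by positivity) (by positivity)]
  linear_combination
    4 * Real.cosh (x * ladderAngle) * Real.sinh (N * ladderAngle) * hs

lemma coshRatio_add_one_sub_sub_one (N x : ℝ) :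
    coshRatio N (x + 1) - coshRatio N (x - 1) = 12 * sinhRatio N x := by
  have h3 : √(3 : ℝ) ≠ 0 := by positivity
  rcases eq_or_ne (Real.sinh (N * ladderAngle)) 0 with h | h
  · simp [sinhRatio, coshRatio, h]
  simp only [sinhRatio, coshRatio, add_mul, sub_mul, one_mul, Real.cosh_add, Real.cosh_sub,
    sinh_ladderAngle]
  field_simp
  ring

lemma sinhRatio_self_sub_one {N : ℝ} (hN : 0 < N) :
    sinhRatio N (N - 1) = 1 / 6 - coshRatio N N / 2 := by
  have := (sinh_mul_ladderAngle_pos hN).ne'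
  have h3 : √(3 : ℝ) ≠ 0 := by positivity
  simp only [sinhRatio, coshRatio, sub_mul, one_mul, Real.sinh_sub, cosh_ladderAngle,
    sinh_ladderAngle]
  field_simp
  linear_combination -24 * Real.cosh (N * ladderAngle) * sqrt_three_sq

/-- The factor in brackets in the closed formulas is `-coth (n θ)`. -/
lemma one_sub_two_div_eq (n : ℕ) (hn : 0 < n) :
    1 - 2 / (1 - (2 - √3) ^ (2 * n)) = -2 * √3 * coshRatio n n := by
  have h3 : √(3 : ℝ) ≠ 0 := by positivity
  have hpos : 0 < (n : ℝ) * ladderAngle := mul_pos (by exact_mod_cast hn) ladderAngle_pos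
  have hs := (Real.sinh_pos_iff.2 hpos).ne'
  set y := (n : ℝ) * ladderAngle with hy
  have he : (2 - √3) ^ (2 * n) = Real.exp (-y) / Real.exp y := by
    rw [← exp_neg_ladderAngle, ← Real.exp_nat_mul, ← Real.exp_sub]
    congr 1
    push_cast
    ring
  have hey := Real.exp_pos y
  have hne : Real.exp y - Real.exp (-y) ≠ 0 := by
    rw [Real.sinh_eq] at hs
    intro h
    exact hs (by rw [h, zero_div])
  rw [he, coshRatio, ← hy, Real.cosh_eq, Real.sinh_eq]
  field_simp
  ring

/-! ### The Green kernel of the ladder -/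

/-- The Green function of the discrete operator `-Δ + 2` on the path `0, 1, …, N - 1` with
reflecting ends, obtained by the method of images. It is the part of the Green kernel of the ladder that is
odd under the exchange of the two rails. -/
def oddKernel (N x y : ℝ) : ℝ := coshRatio N (N - |x - y|) + coshRatio N (N - 1 - x - y)

lemma oddKernel_comm (N x y : ℝ) : oddKernel N x y = oddKernel N y x := by
  rw [oddKernel, oddKernel, abs_sub_comm, sub_right_comm _ x]

lemma oddKernel_self (N x : ℝ) :
    oddKernel N x x = coshRatio N N + coshRatio N (N - 1 - 2 * x) := by
  rw [oddKernel, sub_self, abs_zero, sub_zero]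
  ring_nf

lemma oddKernel_neg_one {N x : ℝ} (hx : 0 ≤ x) : oddKernel N x (-1) = oddKernel N x 0 := by
  rw [oddKernel, oddKernel, abs_of_nonneg (by linarith), abs_of_nonneg (by linarith)]
  ring_nf

lemma oddKernel_end {N x : ℝ} (hx : x ≤ N - 1) : oddKernel N x N = oddKernel N x (N - 1) := by
  rw [oddKernel, oddKernel, abs_of_nonpos (by linarith), abs_of_nonpos (by linarith),
    ← coshRatio_neg N (N - 1 - x - N), ← coshRatio_neg N (N - 1 - x - (N - 1))]
  ring_nf

lemma oddKernel_second_difference {N : ℝ} (hN : 0 < N) (i k : ℕ) :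
    oddKernel N i (k + 1) + oddKernel N i (k - 1) =
      4 * oddKernel N i k - if k = i then 1 else 0 := by
  have h2 : coshRatio N (N - 1 - i - (k + 1)) + coshRatio N (N - 1 - i - (k - 1)) =
      4 * coshRatio N (N - 1 - i - k) := by
    rw [← coshRatio_add_one_add_sub_one, add_comm]
    ring_nf
  have h1 : coshRatio N (N - |(i : ℝ) - (k + 1)|) + coshRatio N (N - |(i : ℝ) - (k - 1)|) =
      4 * coshRatio N (N - |(i : ℝ) - k|) - if k = i then 1 else 0 := by
    rcases lt_trichotomy k i with h | h | h
    · have hr : (k : ℝ) + 1 ≤ i := by exact_mod_cast h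
      rw [abs_of_nonneg (by linarith), abs_of_nonneg (by linarith), abs_of_nonneg (by linarith),
        if_neg h.ne, ← coshRatio_add_one_add_sub_one]
      ring_nf
    · subst h
      have := coshRatio_self_sub_one hN
      simp
      linarith
    · have hr : (i : ℝ) + 1 ≤ k := by exact_mod_cast h
      rw [abs_of_nonpos (by linarith), abs_of_nonpos (by linarith), abs_of_nonpos (by linarith),
        if_neg h.ne', ← coshRatio_add_one_add_sub_one]
      ring_nf
  rw [oddKernel, oddKernel, oddKernel]
  linear_combination h1 + h2

/-- The sign by which a function that is odd under the exchange of the rails differs on the rail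
`s`. -/
def railSign (s : Bool) : ℝ := if s then 1 else -1

/-- The Green kernel of the ladder with `m + 1` rungs. On functions that are equal on the two rails
the Laplacian is that of a path, with Green kernel `min i j`; on odd functions it is `-Δ + 2`. -/
def ladderKernel (m : ℕ) (p q : Fin (m + 1) × Bool) : ℝ :=
  min (p.1 : ℝ) q.1 / 2 + railSign p.2 * railSign q.2 * oddKernel (m + 1) p.1 q.1 / 2

/-- The distribution by which the current of `ladderKernel` leaves: through both ends of the first
rung. -/
def ladderSink (m : ℕ) (v : Fin (m + 1) × Bool) : ℝ := if v.1 = 0 then 1 / 2 else 0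

lemma sum_ladder_edges (m : ℕ) (F : Fin (m + 1) × Bool → Fin (m + 1) × Bool → ℝ) :
    ∑ e, F ((ladder (m + 1)).src e) ((ladder (m + 1)).tgt e) =
      ∑ i : Fin (m + 1), F (i, false) (i, true) +
        ∑ j : Fin m, (F (j.castSucc, false) (j.succ, false) +
          F (j.castSucc, true) (j.succ, true)) := by
  rw [Fintype.sum_sum_type, Fintype.sum_prod_type]
  congr 1
  refine Finset.sum_congr rfl fun j _ => ?_
  rw [Fintype.sum_bool, add_comm]
  rfl

/-- Summation by parts on a path, where `D k` belongs to the edge between `k - 1` and `k`. -/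
lemma sum_mul_succ_sub_castSucc (m : ℕ) (D : ℕ → ℝ) (d : Fin (m + 1) → ℝ) :
    ∑ j : Fin m, D (j + 1) * (d j.succ - d j.castSucc) =
      ∑ k : Fin (m + 1), (D k - D (k + 1)) * d k - D 0 * d 0 + D (m + 1) * d (Fin.last m) := by
  have h1 := Fin.sum_univ_succ fun k : Fin (m + 1) => D k * d k
  have h2 := Fin.sum_univ_castSucc fun k : Fin (m + 1) => D (k + 1) * d k
  simp only [Fin.val_succ, Fin.val_castSucc, Fin.val_zero, Fin.val_last] at h1 h2
  simp only [sub_mul, mul_sub, Finset.sum_sub_distrib, h1, h2]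
  ring

lemma sum_mul_castSucc_add_succ (m : ℕ) (D : ℕ → ℝ) (d : Fin (m + 1) → ℝ) :
    ∑ j : Fin m, D (j + 1) * (d j.castSucc + d j.succ) =
      ∑ k : Fin (m + 1), (D k + D (k + 1)) * d k - D 0 * d 0 - D (m + 1) * d (Fin.last m) := by
  have h1 := Fin.sum_univ_succ fun k : Fin (m + 1) => D k * d k
  have h2 := Fin.sum_univ_castSucc fun k : Fin (m + 1) => D (k + 1) * d k
  simp only [Fin.val_succ, Fin.val_castSucc, Fin.val_zero, Fin.val_last] at h1 h2
  simp only [add_mul, mul_add, Finset.sum_add_distrib, h1, h2]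
  ring

/-- `oddKernel` is a Green kernel of `-Δ + 2`, in weak form. -/
lemma sum_oddKernel (m : ℕ) (i : Fin (m + 1)) (d : Fin (m + 1) → ℝ) :
    2 * ∑ j : Fin (m + 1), oddKernel (m + 1) i j * d j +
      ∑ j : Fin m, (oddKernel (m + 1) i (j + 1) - oddKernel (m + 1) i j) *
        (d j.succ - d j.castSucc) = d i := by
  have hi : (i : ℝ) ≤ m := by exact_mod_cast Nat.lt_succ_iff.1 i.2
  have h := sum_mul_succ_sub_castSucc m
    (fun k => oddKernel (m + 1) i k - oddKernel (m + 1) i (k - 1)) d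
  have h0 : oddKernel (m + 1) i ((0 : ℕ) : ℝ) - oddKernel (m + 1) i ((0 : ℕ) - 1) = 0 := by
    rw [Nat.cast_zero, zero_sub, oddKernel_neg_one (Nat.cast_nonneg _), sub_self]
  have hm : oddKernel (m + 1) i ((m + 1 : ℕ) : ℝ) - oddKernel (m + 1) i ((m + 1 : ℕ) - 1) = 0 := by
    rw [Nat.cast_add_one, oddKernel_end (by linarith), sub_self]
  simp only [h0, hm, zero_mul, sub_zero, add_zero] at h
  simp only [Nat.cast_add_one, add_sub_cancel_right] at h
  rw [h, Finset.mul_sum, ← Finset.sum_add_distrib, Finset.sum_eq_single i]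
  · have := oddKernel_second_difference (N := m + 1) (by positivity) i i
    rw [if_pos rfl] at this
    linear_combination (- d i) * this
  · intro k _ hk
    have := oddKernel_second_difference (N := m + 1) (by positivity) i k
    rw [if_neg (fun h => hk (Fin.ext h))] at this
    linear_combination (- d k) * this
  · simp

/-- `min` is a Green kernel of `-Δ` on the path, with the current leaving at `0`, in weak form. -/
lemma sum_min (m : ℕ) (i : Fin (m + 1)) (d : Fin (m + 1) → ℝ) :
    ∑ j : Fin m, (min (i : ℝ) (j + 1) - min (i : ℝ) j) * (d j.succ - d j.castSucc) =
      d i - d 0 := by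
  have h := sum_mul_succ_sub_castSucc m (fun k => if k ≤ i then 1 else 0) d
  have hD (j : ℕ) : min (i : ℝ) (j + 1) - min (i : ℝ) j = if j + 1 ≤ i then 1 else 0 := by
    split_ifs with hj
    · have : (j : ℝ) + 1 ≤ i := by exact_mod_cast hj
      rw [min_eq_right this, min_eq_right (by linarith)]
      ring
    · have : (i : ℝ) ≤ j := by exact_mod_cast not_lt.1 hj
      rw [min_eq_left this, min_eq_left (by linarith), sub_self]
  simp only [hD, h]
  have hm : ¬ m + 1 ≤ (i : ℕ) := by omega
  rw [if_pos (Nat.zero_le _), if_neg hm, Finset.sum_eq_single i]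
  · simp
  · intro k _ hk
    have hk' : (k : ℕ) ≠ i := fun h => hk (Fin.ext h)
    have : (k : ℕ) ≤ i ↔ (k : ℕ) + 1 ≤ i := by omega
    simp [this]
  · simp

lemma isGreenKernel_ladderKernel (m : ℕ) :
    (ladder (m + 1)).IsGreenKernel (ladderKernel m) (ladderSink m) where
  symm p q := by
    rw [ladderKernel, ladderKernel, min_comm, oddKernel_comm, mul_comm (railSign p.2)]
  sum_eq := by
    rintro ⟨i, s⟩ h
    have hsink : ∑ v, ladderSink m v * h v = (h (0, false) + h (0, true)) / 2 := by
      rw [Fintype.sum_prod_type, Finset.sum_eq_single 0]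
      · rw [Fintype.sum_bool]
        simp only [ladderSink, if_true]
        ring
      · intro k _ hk
        simp [ladderSink, hk]
      · simp
    have hodd := sum_oddKernel m i fun j => h (j, true) - h (j, false)
    have heven := sum_min m i fun j => h (j, true) + h (j, false)
    have key := sum_ladder_edges m fun a b => (ladderKernel m (i, s) b - ladderKernel m (i, s) a) *
      (h b - h a) / 1
    refine key.trans ?_
    rw [hsink]
    have hrhs : h (i, s) = (h (i, true) + h (i, false)) / 2 +
        railSign s * (h (i, true) - h (i, false)) / 2 := by
      cases s <;> simp [railSign] <;> ring
    rw [hrhs]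
    have hcomb : ∀ A B C D : ℝ, 2 * A + B = h (i, true) - h (i, false) →
        C = h (i, true) + h (i, false) - (h (0, true) + h (0, false)) →
        D = railSign s * A + railSign s * B / 2 + C / 2 →
        D = (h (i, true) + h (i, false)) / 2 + railSign s * (h (i, true) - h (i, false)) / 2 -
          (h (0, false) + h (0, true)) / 2 := by
      rintro A B C D h1 h2 rfl
      linear_combination railSign s / 2 * h1 + h2 / 2
    refine hcomb _ _ _ _ hodd heven ?_
    simp only [Finset.mul_sum, Finset.sum_div, add_assoc, ← Finset.sum_add_distrib]
    congr 1
    · refine Finset.sum_congr rfl fun j _ => ?_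
      simp only [ladderKernel, railSign, if_true, Bool.false_eq_true, if_false]
      ring
    · refine Finset.sum_congr rfl fun j _ => ?_
      simp only [ladderKernel, railSign, if_true, Bool.false_eq_true, if_false, Fin.val_succ,
        Fin.val_castSucc, Nat.cast_add_one]
      ring

open MetrizedGraph

/-! ### Resistances and edge densities in the ladder -/

lemma kernelResistance_ladderKernel (m : ℕ) (i j : Fin (m + 1)) (s s' : Bool) :
    kernelResistance (ladderKernel m) (i, s) (j, s') = |(i : ℝ) - j| / 2 +
      (oddKernel (m + 1) i i + oddKernel (m + 1) j j) / 2 -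
        railSign s * railSign s' * oddKernel (m + 1) i j := by
  have hs : ∀ s, railSign s * railSign s = 1 := by simp [railSign]
  have hmin : min (i : ℝ) j = (i + j - |(i : ℝ) - j|) / 2 := by
    rcases le_total (i : ℝ) j with h | h
    · rw [min_eq_left h, abs_of_nonpos (by linarith)]
      ring
    · rw [min_eq_right h, abs_of_nonneg (by linarith)]
      ring
  simp only [kernelResistance, ladderKernel, hs, hmin, min_self]
  ring

/-- The density `1 / (1 + R_e)` of the canonical measure on the `i`-th rung. -/
def rungDensity (N i : ℝ) : ℝ := 1 - 2 * coshRatio N N - 2 * coshRatio N (N - 1 - 2 * i)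

/-- The density `1 / (1 + R_e)` on the edges that join the rungs `k - 1` and `k`. It vanishes at
`k = 0` and `k = N`, where there are no such edges. -/
def railDensity (N k : ℝ) : ℝ := coshRatio N N - coshRatio N (N - 2 * k)

lemma one_sub_kernelResistance_rung (m : ℕ) (i : Fin (m + 1)) :
    1 - kernelResistance (ladderKernel m) (i, false) (i, true) = rungDensity (m + 1) i := by
  rw [kernelResistance_ladderKernel, oddKernel_self, rungDensity]
  simp [railSign]
  ring

lemma one_sub_kernelResistance_rail (m : ℕ) (j : Fin m) (s : Bool) :
    1 - kernelResistance (ladderKernel m) (j.castSucc, s) (j.succ, s) =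
      railDensity (m + 1) (j + 1) := by
  have hs : railSign s * railSign s = 1 := by cases s <;> simp [railSign]
  have h1 := coshRatio_self_sub_one (N := m + 1) (by positivity)
  have h2 := coshRatio_add_one_add_sub_one (m + 1) ((m + 1 : ℝ) - 2 * (j + 1))
  rw [kernelResistance_ladderKernel, oddKernel_self, oddKernel_self, oddKernel, hs, railDensity]
  simp only [Fin.val_succ, Fin.val_castSucc, Nat.cast_add_one, sub_add_cancel_left, abs_neg,
    abs_one]
  have e1 : (m + 1 : ℝ) - 2 * (j + 1) + 1 = m + 1 - 1 - 2 * j := by ring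
  have e2 : (m + 1 : ℝ) - 2 * (j + 1) - 1 = m + 1 - 1 - 2 * (j + 1) := by ring
  have e3 : (m + 1 : ℝ) - 1 - j - (j + 1) = m + 1 - 2 * (j + 1) := by ring
  rw [e1, e2] at h2
  rw [e3]
  linear_combination h1 - h2 / 2

/-- Positivity of the densities says that no edge is a bridge, which fails for a single rung. -/
lemma edgeDensity_ladder_pos {m : ℕ} (hm : 0 < m) :
    ∀ e, 0 < edgeDensity (ladder (m + 1)) (ladderKernel m) e := by
  have hm' : (0 : ℝ) < m := by exact_mod_cast hm
  rintro (i | ⟨j, s⟩)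
  · refine lt_of_lt_of_eq ?_ (one_sub_kernelResistance_rung m i).symm
    have hi : (i : ℝ) ≤ m := by exact_mod_cast Nat.lt_succ_iff.1 i.2
    have hi0 : (0 : ℝ) ≤ i := Nat.cast_nonneg _
    have h1 := coshRatio_self_sub_one (N := m + 1) (by positivity)
    have h2 := coshRatio_self_lt (N := m + 1) (by linarith)
    have h3 := coshRatio_le_sub_one (N := m + 1) (x := m + 1 - 1 - 2 * i) (by linarith)
      (abs_le.2 ⟨by linarith, by linarith⟩)
    rw [rungDensity]
    linarith
  · refine lt_of_lt_of_eq ?_ (one_sub_kernelResistance_rail m j s).symm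
    have hj : (j : ℝ) + 1 ≤ m := by exact_mod_cast (show (j : ℕ) < m from j.2)
    have hj0 : (0 : ℝ) ≤ (j : ℕ) := Nat.cast_nonneg _
    exact sub_pos.2 (coshRatio_lt_self (abs_lt.2 ⟨by linarith, by linarith⟩))

/-! ### Summation along the rungs -/

/-- The value `E (N - 1 - 2 i)` of `coshRatio` belonging to the `i`-th rung. -/
def rungCosh (N i : ℝ) : ℝ := coshRatio N (N - 1 - 2 * i)

lemma rungCosh_eq_sub (N i : ℝ) :
    rungCosh N i = sinhRatio N (N - 2 * i) - sinhRatio N (N - 2 * (i + 1)) := by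
  rw [rungCosh, ← sinhRatio_add_one_sub_sub_one]
  ring_nf

lemma sum_range_rungCosh (N : ℝ) (k : ℕ) :
    ∑ j ∈ Finset.range k, rungCosh N j = sinhRatio N N - sinhRatio N (N - 2 * k) := by
  have := Finset.sum_range_sub' (fun j : ℕ => sinhRatio N (N - 2 * j)) k
  simpa only [rungCosh_eq_sub, Nat.cast_add_one, Nat.cast_zero, mul_zero, sub_zero] using this

section Sums

variable (m : ℕ)

lemma sum_rungCosh : ∑ j ∈ Finset.range (m + 1), rungCosh (m + 1) j = 1 / 6 := by
  have h : (m + 1 : ℝ) - 2 * ((m + 1 : ℕ) : ℝ) = -(m + 1) := by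
    push_cast
    ring
  rw [sum_range_rungCosh, h, sinhRatio_neg, sinhRatio_self (by positivity)]
  norm_num

lemma sum_coshRatio_rail :
    ∑ j ∈ Finset.range m, coshRatio (m + 1) (m + 1 - 2 * (j + 1)) =
      1 / 3 - coshRatio (m + 1) (m + 1) := by
  have h1 : ∀ j : ℕ, coshRatio (m + 1) (m + 1 - 2 * (j + 1)) =
      sinhRatio (m + 1) (m + 1 - 1 - 2 * j) -
        sinhRatio (m + 1) (m + 1 - 1 - 2 * ((j + 1 : ℕ) : ℝ)) := fun j => by
    rw [← sinhRatio_add_one_sub_sub_one]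
    push_cast
    ring_nf
  have h2 : (m + 1 : ℝ) - 1 - 2 * m = -(m + 1 - 1) := by ring
  simp only [h1]
  rw [Finset.sum_range_sub' fun j : ℕ => sinhRatio (m + 1) (m + 1 - 1 - 2 * j), h2, sinhRatio_neg,
    Nat.cast_zero, mul_zero, sub_zero, sinhRatio_self_sub_one (by positivity)]
  ring

/-- `cosh ^ 2 x = (cosh (2 x) + 1) / 2`, where `cosh (2 x)` is again a difference. -/
lemma coshRatio_sq {N : ℝ} (hN : 0 < N) (x : ℝ) :
    coshRatio N x ^ 2 = (coshRatio N N ^ 2 / 2 - 1 / 24) +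
      (Real.sinh (2 * ((x + 1) * ladderAngle)) - Real.sinh (2 * ((x - 1) * ladderAngle))) /
        (192 * √3 * Real.sinh (N * ladderAngle) ^ 2) := by
  have hS := (sinh_mul_ladderAngle_pos hN).ne'
  have h3 : √(3 : ℝ) ≠ 0 := by positivity
  have h3' := sqrt_three_sq
  have hc : Real.cosh (N * ladderAngle) ^ 2 = Real.sinh (N * ladderAngle) ^ 2 + 1 :=
    Real.cosh_sq _
  have hd : Real.sinh (2 * ((x + 1) * ladderAngle)) - Real.sinh (2 * ((x - 1) * ladderAngle)) =
      8 * √3 * (2 * Real.cosh (x * ladderAngle) ^ 2 - 1) := by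
    have hx := Real.cosh_sq (x * ladderAngle)
    simp only [Real.sinh_two_mul, add_mul, sub_mul, one_mul, Real.sinh_add, Real.sinh_sub,
      Real.cosh_add, Real.cosh_sub, cosh_ladderAngle, sinh_ladderAngle]
    linear_combination (-8 * √3) * hx
  rw [hd, coshRatio, coshRatio, div_pow, div_pow, mul_pow, mul_pow, h3', hc]
  generalize Real.sinh (N * ladderAngle) = S at *
  field_simp
  ring

lemma sinh_two_mul_div {N : ℝ} (hN : 0 < N) :
    Real.sinh (2 * (N * ladderAngle)) / (192 * √3 * Real.sinh (N * ladderAngle) ^ 2) =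
      coshRatio N N / 48 := by
  have hS := (sinh_mul_ladderAngle_pos hN).ne'
  have h3 : √(3 : ℝ) ≠ 0 := by positivity
  rw [Real.sinh_two_mul, coshRatio]
  field_simp
  ring

lemma sinh_two_mul_sub_one_div {N : ℝ} (hN : 0 < N) :
    Real.sinh (2 * ((N - 1) * ladderAngle)) / (192 * √3 * Real.sinh (N * ladderAngle) ^ 2) =
      7 * coshRatio N N / 48 - 1 / 48 - coshRatio N N ^ 2 / 4 := by
  have hS := (sinh_mul_ladderAngle_pos hN).ne'
  have h3 : √(3 : ℝ) ≠ 0 := by positivity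
  have h3' := sqrt_three_sq
  have hc : Real.cosh (N * ladderAngle) ^ 2 = Real.sinh (N * ladderAngle) ^ 2 + 1 :=
    Real.cosh_sq _
  rw [sub_mul, one_mul, Real.sinh_two_mul, Real.sinh_sub, Real.cosh_sub, cosh_ladderAngle,
    sinh_ladderAngle, coshRatio, div_pow, mul_pow, mul_pow, h3', hc]
  field_simp
  linear_combination 4608 * Real.sinh (N * ladderAngle) * Real.cosh (N * ladderAngle) * h3' -
    9216 * √3 * hc

lemma sum_rungCosh_sq :
    ∑ j ∈ Finset.range (m + 1), rungCosh (m + 1) j ^ 2 =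
      (m + 1) * (coshRatio (m + 1) (m + 1) ^ 2 / 2 - 1 / 24) +
        coshRatio (m + 1) (m + 1) / 24 := by
  have hN : (0 : ℝ) < m + 1 := by positivity
  have h1 : ∀ j : ℕ, rungCosh (m + 1) j ^ 2 = (coshRatio (m + 1) (m + 1) ^ 2 / 2 - 1 / 24) +
      (Real.sinh (2 * ((m + 1 - 2 * j) * ladderAngle)) -
        Real.sinh (2 * ((m + 1 - 2 * ((j + 1 : ℕ) : ℝ)) * ladderAngle))) /
        (192 * √3 * Real.sinh ((m + 1) * ladderAngle) ^ 2) := fun j => by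
    rw [rungCosh, coshRatio_sq hN]
    push_cast
    ring_nf
  have h2 : (2 : ℝ) * ((m + 1 - 2 * ((m + 1 : ℕ) : ℝ)) * ladderAngle) =
      -(2 * ((m + 1) * ladderAngle)) := by
    push_cast
    ring
  simp only [h1]
  rw [Finset.sum_add_distrib, ← Finset.sum_div,
    Finset.sum_range_sub' fun j : ℕ => Real.sinh (2 * ((m + 1 - 2 * j) * ladderAngle)), h2,
    Real.sinh_neg, Nat.cast_zero, mul_zero, sub_zero, sub_neg_eq_add, add_div, sinh_two_mul_div hN]
  simp
  ring

lemma sum_coshRatio_rail_sq :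
    ∑ j ∈ Finset.range m, coshRatio (m + 1) (m + 1 - 2 * (j + 1)) ^ 2 =
      (m - 1) * (coshRatio (m + 1) (m + 1) ^ 2 / 2 - 1 / 24) +
        7 * coshRatio (m + 1) (m + 1) / 24 - 1 / 12 := by
  have hN : (0 : ℝ) < m + 1 := by positivity
  have h1 : ∀ j : ℕ, coshRatio (m + 1) (m + 1 - 2 * (j + 1)) ^ 2 =
      (coshRatio (m + 1) (m + 1) ^ 2 / 2 - 1 / 24) +
      (Real.sinh (2 * ((m + 1 - 1 - 2 * j) * ladderAngle)) -
        Real.sinh (2 * ((m + 1 - 1 - 2 * ((j + 1 : ℕ) : ℝ)) * ladderAngle))) /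
        (192 * √3 * Real.sinh ((m + 1) * ladderAngle) ^ 2) := fun j => by
    rw [coshRatio_sq hN]
    push_cast
    ring_nf
  have h2 : (2 : ℝ) * ((m + 1 - 1 - 2 * m) * ladderAngle) =
      -(2 * ((m + 1 - 1) * ladderAngle)) := by ring
  simp only [h1]
  rw [Finset.sum_add_distrib, ← Finset.sum_div,
    Finset.sum_range_sub' fun j : ℕ => Real.sinh (2 * ((m + 1 - 1 - 2 * j) * ladderAngle)), h2,
    Real.sinh_neg, Nat.cast_zero, mul_zero, sub_zero, sub_neg_eq_add, add_div,
    sinh_two_mul_sub_one_div hN]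
  simp
  ring

end Sums

lemma sum_abs_sub_succ (e : ℕ → ℝ) {n i : ℕ} (hi : i + 1 ≤ n) :
    ∑ j ∈ Finset.range n, |((i + 1 : ℕ) : ℝ) - j| * e j =
      ∑ j ∈ Finset.range n, |(i : ℝ) - j| * e j + 2 * ∑ j ∈ Finset.range (i + 1), e j -
        ∑ j ∈ Finset.range n, e j := by
  have h : ∀ j ∈ Finset.range n, |((i + 1 : ℕ) : ℝ) - j| * e j =
      |(i : ℝ) - j| * e j + 2 * (if j ∈ Finset.range (i + 1) then e j else 0) - e j := by
    intro j _
    split_ifs with hj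
    · have : (j : ℝ) ≤ i := by exact_mod_cast Nat.lt_succ_iff.1 (Finset.mem_range.1 hj)
      rw [abs_of_nonneg (by push_cast; linarith), abs_of_nonneg (by linarith)]
      push_cast
      ring
    · have : (i : ℝ) + 1 ≤ j := by exact_mod_cast not_lt.1 (fun h => hj (Finset.mem_range.2 h))
      rw [abs_of_nonpos (by push_cast; linarith), abs_of_nonpos (by linarith)]
      push_cast
      ring
  rw [Finset.sum_congr rfl h, Finset.sum_sub_distrib, Finset.sum_add_distrib, ← Finset.mul_sum,
    Finset.sum_ite_mem, Finset.inter_eq_right.2 (Finset.range_subset_range.2 hi)]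

lemma sum_abs_sub (m : ℕ) {i : ℕ} (hi : i ≤ m) :
    ∑ j ∈ Finset.range (m + 1), |(i : ℝ) - j| = (i : ℝ) ^ 2 - m * i + m * (m + 1) / 2 := by
  induction i with
  | zero =>
    have h := Finset.sum_range_id_mul_two (m + 1)
    rw [Nat.add_sub_cancel] at h
    have h' := congrArg (Nat.cast : ℕ → ℝ) h
    push_cast at h'
    simp
    linarith
  | succ i ih =>
    have h := sum_abs_sub_succ (fun _ => 1) (n := m + 1) (i := i) (by omega)
    simp only [mul_one] at h
    rw [h, ih (by omega)]
    simp
    ring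

/-- Summation by reflection: `rungCosh` is symmetric about the middle of the ladder. -/
lemma sum_mul_rungCosh (m : ℕ) :
    ∑ j ∈ Finset.range (m + 1), (j : ℝ) * rungCosh (m + 1) j = m / 12 := by
  have h1 := Finset.sum_range_reflect (fun j : ℕ => (j : ℝ) * rungCosh (m + 1) j) (m + 1)
  have h2 : ∀ j ∈ Finset.range (m + 1), ((m + 1 - 1 - j : ℕ) : ℝ) *
      rungCosh (m + 1) ((m + 1 - 1 - j : ℕ) : ℝ) =
      m * rungCosh (m + 1) j - j * rungCosh (m + 1) j := by
    intro j hj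
    have hj' : j ≤ m := Nat.lt_succ_iff.1 (Finset.mem_range.1 hj)
    have : rungCosh (m + 1) ((m : ℝ) - j) = rungCosh (m + 1) j := by
      rw [rungCosh, rungCosh, ← coshRatio_neg]
      ring_nf
    rw [Nat.add_sub_cancel, Nat.cast_sub hj', this]
    ring
  rw [Finset.sum_congr rfl h2, Finset.sum_sub_distrib, ← Finset.mul_sum, sum_rungCosh] at h1
  linarith

/-- As functions of `i`, the two sides have the same first difference: both second differences are
`2 * rungCosh`. -/
lemma sum_abs_sub_mul_rungCosh (m : ℕ) {i : ℕ} (hi : i ≤ m) :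
    ∑ j ∈ Finset.range (m + 1), |(i : ℝ) - j| * rungCosh (m + 1) j =
      rungCosh (m + 1) i / 6 + (m + 1) / 12 - coshRatio (m + 1) (m + 1) / 3 := by
  induction i with
  | zero =>
    have h := coshRatio_self_sub_one (N := m + 1) (by positivity)
    have h' := sum_mul_rungCosh m
    simp only [rungCosh, Nat.cast_zero, zero_sub, abs_neg, Nat.abs_cast, mul_zero, sub_zero] at *
    rw [h', h]
    ring
  | succ i ih =>
    have h := coshRatio_add_one_sub_sub_one (m + 1) ((m + 1 : ℝ) - 2 * ((i + 1 : ℕ) : ℝ))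
    have e1 : (m + 1 : ℝ) - 2 * ((i + 1 : ℕ) : ℝ) + 1 = m + 1 - 1 - 2 * i := by push_cast; ring
    have e2 : (m + 1 : ℝ) - 2 * ((i + 1 : ℕ) : ℝ) - 1 = m + 1 - 1 - 2 * ((i + 1 : ℕ) : ℝ) := by
      ring
    rw [e1, e2] at h
    rw [sum_abs_sub_succ (fun j => rungCosh (m + 1) j) (by omega), ih (by omega), sum_rungCosh,
      sum_range_rungCosh, sinhRatio_self (by positivity), rungCosh, rungCosh]
    linear_combination h / 6

lemma sum_sum_abs_sub (m : ℕ) :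
    ∑ i ∈ Finset.range (m + 1), ((i : ℝ) ^ 2 - m * i + m * (m + 1) / 2) =
      (m : ℝ) * (m + 1) * (m + 2) / 3 := by
  have h : ∀ k : ℕ, ∑ i ∈ Finset.range k, ((i : ℝ) ^ 2 - m * i + m * (m + 1) / 2) =
      (k : ℝ) * (k - 1) * (2 * k - 1) / 6 - m * (k * (k - 1) / 2) + k * (m * (m + 1) / 2) := by
    intro k
    induction k with
    | zero => simp
    | succ k ih =>
      rw [Finset.sum_range_succ, ih]
      push_cast
      ring
  rw [h]
  push_cast
  ring

/-- The sum over the pairs is taken first over the other index. -/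
lemma sum_abs_sub_mul_rungCosh_rungs (m : ℕ) :
    ∑ i ∈ Finset.range (m + 1), ((i : ℝ) ^ 2 - m * i + m * (m + 1) / 2) * rungCosh (m + 1) i =
      1 / 36 + (m + 1) * ((m + 1) / 12 - coshRatio (m + 1) (m + 1) / 3) := by
  have h1 : ∀ i ∈ Finset.range (m + 1),
      ((i : ℝ) ^ 2 - m * i + m * (m + 1) / 2) * rungCosh (m + 1) i =
        ∑ j ∈ Finset.range (m + 1), |(j : ℝ) - i| * rungCosh (m + 1) i := by
    intro i hi
    rw [← sum_abs_sub m (Nat.lt_succ_iff.1 (Finset.mem_range.1 hi)), Finset.sum_mul]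
    simp only [abs_sub_comm]
  rw [Finset.sum_congr rfl h1, Finset.sum_comm, Finset.sum_congr rfl fun j hj =>
    sum_abs_sub_mul_rungCosh m (Nat.lt_succ_iff.1 (Finset.mem_range.1 hj))]
  simp only [Finset.sum_sub_distrib, Finset.sum_add_distrib, ← Finset.sum_div, sum_rungCosh]
  simp
  ring

/-! ### The invariants of the ladder -/

/-- The canonical measure, with the mass of each edge split equally between its end points, gives
the weight `(1 - 6 E) / 2` to both vertices of the rung with `rungCosh` equal to `E`. -/
lemma sum_edgeDensity_mul_ladder (m : ℕ) (u : Fin (m + 1) × Bool → ℝ) :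
    ∑ e, edgeDensity (ladder (m + 1)) (ladderKernel m) e *
        ((u ((ladder (m + 1)).src e) + u ((ladder (m + 1)).tgt e)) / 2) =
      ∑ i : Fin (m + 1), (1 - 6 * rungCosh (m + 1) i) * ((u (i, false) + u (i, true)) / 2) := by
  have h := sum_mul_castSucc_add_succ m (fun k => railDensity (m + 1) k)
    fun i => (u (i, false) + u (i, true)) / 2
  have h0 : railDensity (m + 1) ((0 : ℕ) : ℝ) = 0 := by simp [railDensity]
  have hm : railDensity (m + 1) ((m + 1 : ℕ) : ℝ) = 0 := by
    rw [railDensity, ← coshRatio_neg _ (_ - _), sub_eq_zero]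
    push_cast
    ring_nf
  rw [h0, hm, zero_mul, zero_mul, sub_zero, sub_zero] at h
  have hw (k : ℕ) : 1 - 6 * rungCosh (m + 1) k = rungDensity (m + 1) k +
      (railDensity (m + 1) k + railDensity (m + 1) ((k + 1 : ℕ) : ℝ)) := by
    have hE := coshRatio_add_one_add_sub_one (m + 1) ((m + 1 : ℝ) - 1 - 2 * k)
    have e1 : (m + 1 : ℝ) - 1 - 2 * k + 1 = m + 1 - 2 * k := by ring
    have e2 : (m + 1 : ℝ) - 1 - 2 * k - 1 = m + 1 - 2 * ((k + 1 : ℕ) : ℝ) := by push_cast; ring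
    rw [e1, e2] at hE
    rw [rungCosh, rungDensity, railDensity, railDensity]
    linear_combination hE
  refine (sum_ladder_edges m fun a b =>
    (1 - kernelResistance (ladderKernel m) a b) * ((u a + u b) / 2)).trans ?_
  simp only [one_sub_kernelResistance_rung, one_sub_kernelResistance_rail, hw,
    add_mul (rungDensity _ _),
    Finset.sum_add_distrib (f := fun i : Fin (m + 1) => rungDensity (m + 1) i * _)]
  rw [← h]
  congr 1
  refine Finset.sum_congr rfl fun j _ => ?_
  push_cast
  ring

/-- An instance of Foster's theorem: the canonical densities sum to the genus. -/
lemma sum_edgeDensity_ladder (m : ℕ) :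
    ∑ e, edgeDensity (ladder (m + 1)) (ladderKernel m) e = m := by
  have h := sum_edgeDensity_mul_ladder m fun _ => 1
  have h1 := Fin.sum_univ_eq_sum_range (fun j => rungCosh (m + 1) j) (m + 1)
  rw [sum_rungCosh] at h1
  simp only [add_self_div_two, mul_one, Finset.sum_sub_distrib, ← Finset.mul_sum, h1,
    Finset.sum_const, Finset.card_univ, Fintype.card_fin, nsmul_eq_mul] at h
  rw [h]
  push_cast
  ring

/-- The sum of the squares of the edge densities of the ladder with `m + 1` rungs, as a function of
`t = coshRatio (m + 1) (m + 1)`. -/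
def sumSqDensity (m t : ℝ) : ℝ :=
  9 * (m + 1) * t ^ 2 - (4 * m + 13 / 4) * t + 3 * m / 4 + 1 / 12

lemma sum_edgeDensity_sq_ladder (m : ℕ) :
    ∑ e, edgeDensity (ladder (m + 1)) (ladderKernel m) e ^ 2 =
      sumSqDensity m (coshRatio (m + 1) (m + 1)) := by
  refine (sum_ladder_edges m fun a b =>
    (1 - kernelResistance (ladderKernel m) a b) ^ 2).trans ?_
  simp only [one_sub_kernelResistance_rung, one_sub_kernelResistance_rail]
  rw [Fin.sum_univ_eq_sum_range (fun j => rungDensity (m + 1) j ^ 2) (m + 1),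
    Fin.sum_univ_eq_sum_range (fun j : ℕ =>
      railDensity (m + 1) (j + 1) ^ 2 + railDensity (m + 1) (j + 1) ^ 2) m]
  set t := coshRatio (m + 1) (m + 1) with ht
  have h1 (j : ℕ) : rungDensity (m + 1) j ^ 2 =
      (1 - 2 * t) ^ 2 - 4 * (1 - 2 * t) * rungCosh (m + 1) j + 4 * rungCosh (m + 1) j ^ 2 := by
    rw [rungDensity, rungCosh]
    ring
  have h2 (j : ℕ) : railDensity (m + 1) (j + 1) ^ 2 + railDensity (m + 1) (j + 1) ^ 2 =
      2 * t ^ 2 - 4 * t * coshRatio (m + 1) (m + 1 - 2 * (j + 1)) +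
        2 * coshRatio (m + 1) (m + 1 - 2 * (j + 1)) ^ 2 := by
    rw [railDensity]
    ring
  simp only [h1, h2, Finset.sum_sub_distrib, Finset.sum_add_distrib, ← Finset.mul_sum,
    sum_rungCosh, sum_rungCosh_sq, sum_coshRatio_rail, sum_coshRatio_rail_sq, Finset.sum_const,
    Finset.card_range, nsmul_eq_mul, sumSqDensity, ← ht]
  push_cast
  ring

/-- The terms in `t ^ 2`, where `t = coshRatio (m + 1) (m + 1)`, cancel between the sum of
`rungCosh ^ 2` and the sum of the squared densities. -/
lemma resistanceMean_ladder (m : ℕ) (i : Fin (m + 1)) (s : Bool) :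
    resistanceMean (ladder (m + 1)) (ladderKernel m) (i, s) =
      ((i : ℝ) ^ 2 - m * i + m * (m + 1) / 2) / 2 + (m - 1) / 2 * rungCosh (m + 1) i +
        ((m + 1) * coshRatio (m + 1) (m + 1) / 3 - 1 / 36) := by
  have hi : (i : ℕ) ≤ m := Nat.lt_succ_iff.1 i.2
  have h := sum_edgeDensity_mul_ladder m fun v => kernelResistance (ladderKernel m) (i, s) v
  set t := coshRatio (m + 1) (m + 1) with ht
  have hu (j : Fin (m + 1)) : (1 - 6 * rungCosh (m + 1) j) *
      ((kernelResistance (ladderKernel m) (i, s) (j, false) +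
        kernelResistance (ladderKernel m) (i, s) (j, true)) / 2) =
      |(i : ℝ) - j| / 2 - 3 * (|(i : ℝ) - j| * rungCosh (m + 1) j) +
        (t + rungCosh (m + 1) i / 2) + (1 / 2 - 3 * (2 * t + rungCosh (m + 1) i)) *
          rungCosh (m + 1) j - 3 * rungCosh (m + 1) j ^ 2 := by
    simp only [kernelResistance_ladderKernel, oddKernel_self, ← ht, ← rungCosh.eq_1, railSign,
      if_true, Bool.false_eq_true, if_false]
    ring
  simp only [hu] at h
  rw [Fin.sum_univ_eq_sum_range (fun j : ℕ => |(i : ℝ) - j| / 2 -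
    3 * (|(i : ℝ) - j| * rungCosh (m + 1) j) + (t + rungCosh (m + 1) i / 2) +
      (1 / 2 - 3 * (2 * t + rungCosh (m + 1) i)) * rungCosh (m + 1) j -
        3 * rungCosh (m + 1) j ^ 2) (m + 1)] at h
  simp only [Finset.sum_sub_distrib, Finset.sum_add_distrib, ← Finset.mul_sum, ← Finset.sum_div,
    sum_rungCosh, sum_rungCosh_sq, sum_abs_sub m hi, sum_abs_sub_mul_rungCosh m hi,
    Finset.sum_const, Finset.card_range, nsmul_eq_mul, ← ht] at h
  have hsq : ∑ e, edgeDensity (ladder (m + 1)) (ladderKernel m) e *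
      (edgeDensity (ladder (m + 1)) (ladderKernel m) e / 6) = sumSqDensity m t / 6 := by
    rw [← sum_edgeDensity_sq_ladder, Finset.sum_div]
    exact Finset.sum_congr rfl fun _ _ => by ring
  simp only [resistanceMean, mul_add, Finset.sum_add_distrib]
  simp only [mul_add, add_div] at h
  simp only [add_div, mul_add]
  rw [hsq, h, sumSqDensity]
  push_cast
  ring

/-- The sum over one rail of the values of `resistanceMean`. -/
lemma sum_resistanceMean_ladder (m : ℕ) :
    ∑ i : Fin (m + 1), resistanceMean (ladder (m + 1)) (ladderKernel m) (i, false) =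
      m * (m + 1) * (m + 2) / 6 + (m - 1) / 12 +
        (m + 1) * ((m + 1) * coshRatio (m + 1) (m + 1) / 3 - 1 / 36) := by
  simp only [resistanceMean_ladder]
  rw [Fin.sum_univ_eq_sum_range (fun i : ℕ => ((i : ℝ) ^ 2 - m * i + m * (m + 1) / 2) / 2 +
    (m - 1) / 2 * rungCosh (m + 1) i + ((m + 1) * coshRatio (m + 1) (m + 1) / 3 - 1 / 36)) (m + 1)]
  rw [Finset.sum_add_distrib, Finset.sum_add_distrib]
  simp only [← Finset.sum_div, ← Finset.mul_sum, sum_sum_abs_sub, sum_rungCosh,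
    Finset.sum_const, Finset.card_range, nsmul_eq_mul]
  push_cast
  ring

lemma genus_ladder (m : ℕ) : (ladder (m + 1)).genus = m := by
  simp only [genus, Fintype.card_sum, Fintype.card_prod, Fintype.card_fin, Fintype.card_bool,
    Nat.add_sub_cancel]
  push_cast
  ring

lemma totalLength_ladder (m : ℕ) : (ladder (m + 1)).totalLength = 3 * m + 1 := by
  have h : ∀ e, (ladder (m + 1)).len e = 1 := fun _ => rfl
  simp only [totalLength, h, Finset.sum_const, Finset.card_univ, Fintype.card_sum,
    Fintype.card_prod, Fintype.card_fin, Fintype.card_bool, Nat.add_sub_cancel, nsmul_eq_mul]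
  push_cast
  ring

lemma epsilonInv_ladder {m : ℕ} (hm : 0 < m) :
    (ladder (m + 1)).epsilonInv =
      ((3 * m ^ 2 + 3 * m + 10) * (m - 1) / 9 +
        2 * (m - 1) * (m - 5) * coshRatio (m + 1) (m + 1) / 3) / m := by
  rw [(isGreenKernel_ladderKernel m).epsilonInv_eq (fun _ => rfl)
    (by rw [genus_ladder]; positivity) (edgeDensity_ladder_pos hm), genus_ladder]
  congr 1
  set P := resistanceMean (ladder (m + 1)) (ladderKernel m) with hP
  have hPs (i : Fin (m + 1)) : P (i, true) = P (i, false) := by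
    rw [hP, resistanceMean_ladder, resistanceMean_ladder]
  have h2 := sum_mul_castSucc_add_succ m (fun _ => 1) fun i => P (i, false)
  have h3 := sum_resistanceMean_ladder m
  have h0 := resistanceMean_ladder m 0 false
  have hl := resistanceMean_ladder m (Fin.last m) false
  have hE := coshRatio_self_sub_one (N := m + 1) (by positivity)
  have hE0 : rungCosh (m + 1) ((0 : ℕ) : ℝ) = coshRatio (m + 1) (m + 1 - 1) := by
    simp [rungCosh]
  have hEl : rungCosh (m + 1) m = coshRatio (m + 1) (m + 1 - 1) := by
    rw [rungCosh, ← coshRatio_neg]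
    ring_nf
  rw [Fin.val_zero, hE0, hE] at h0
  rw [Fin.val_last, hEl, hE] at hl
  simp only [one_mul, Finset.sum_add_distrib, add_mul] at h2
  rw [sum_ladder_edges m fun a b => P a + P b, Fintype.sum_prod_type]
  simp only [Fintype.sum_bool, hPs, Finset.sum_add_distrib]
  rw [← hP] at h3 h0 hl
  rw [h3, h0, hl] at h2
  rw [h3]
  push_cast at h2
  linear_combination 2 * h2

lemma zInv_ladder {m : ℕ} (hm : 0 < m) :
    (ladder (m + 1)).zInv =
      ((3 * (m + 1) ^ 2 - 13) * (m + 1) / 36 -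
        (m + 1) * (m - 5) * coshRatio (m + 1) (m + 1) / 6) / m ^ 2 := by
  have hm' : (m : ℝ) ≠ 0 := by exact_mod_cast hm.ne'
  rw [(isGreenKernel_ladderKernel m).zInv_eq (fun _ => rfl)
    (by rw [genus_ladder]; positivity) (edgeDensity_ladder_pos hm), genus_ladder,
    sum_edgeDensity_ladder]
  have h1 := sum_edgeDensity_mul_ladder m (resistanceMean (ladder (m + 1)) (ladderKernel m))
  have h2 : ∑ e, edgeDensity (ladder (m + 1)) (ladderKernel m) e *
      (edgeDensity (ladder (m + 1)) (ladderKernel m) e * (m - 1) / 6) =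
      sumSqDensity m (coshRatio (m + 1) (m + 1)) * (m - 1) / 6 := by
    rw [← sum_edgeDensity_sq_ladder, mul_div_assoc, Finset.sum_mul]
    exact Finset.sum_congr rfl fun _ _ => by ring
  have h3 := sum_resistanceMean_ladder m
  have h4 : ∑ i : Fin (m + 1), rungCosh (m + 1) i *
      resistanceMean (ladder (m + 1)) (ladderKernel m) (i, false) =
      (1 / 36 + (m + 1) * ((m + 1) / 12 - coshRatio (m + 1) (m + 1) / 3)) / 2 +
        (m - 1) / 2 * ((m + 1) * (coshRatio (m + 1) (m + 1) ^ 2 / 2 - 1 / 24) +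
          coshRatio (m + 1) (m + 1) / 24) +
        ((m + 1) * coshRatio (m + 1) (m + 1) / 3 - 1 / 36) / 6 := by
    have h5 (i : Fin (m + 1)) : rungCosh (m + 1) i *
        resistanceMean (ladder (m + 1)) (ladderKernel m) (i, false) =
        ((i : ℝ) ^ 2 - m * i + m * (m + 1) / 2) * rungCosh (m + 1) i / 2 +
          (m - 1) / 2 * rungCosh (m + 1) i ^ 2 +
          ((m + 1) * coshRatio (m + 1) (m + 1) / 3 - 1 / 36) * rungCosh (m + 1) i := by
      rw [resistanceMean_ladder]
      ring
    simp only [h5]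
    rw [Fin.sum_univ_eq_sum_range (fun i : ℕ =>
      ((i : ℝ) ^ 2 - m * i + m * (m + 1) / 2) * rungCosh (m + 1) i / 2 +
        (m - 1) / 2 * rungCosh (m + 1) i ^ 2 +
        ((m + 1) * coshRatio (m + 1) (m + 1) / 3 - 1 / 36) * rungCosh (m + 1) i) (m + 1),
      Finset.sum_add_distrib, Finset.sum_add_distrib, ← Finset.sum_div, ← Finset.mul_sum,
      ← Finset.mul_sum, sum_abs_sub_mul_rungCosh_rungs, sum_rungCosh_sq, sum_rungCosh]
    ring
  have h6 (i : Fin (m + 1)) : (1 - 6 * rungCosh (m + 1) i) *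
      ((resistanceMean (ladder (m + 1)) (ladderKernel m) (i, false) +
        resistanceMean (ladder (m + 1)) (ladderKernel m) (i, true)) / 2) =
      resistanceMean (ladder (m + 1)) (ladderKernel m) (i, false) -
        6 * (rungCosh (m + 1) i *
          resistanceMean (ladder (m + 1)) (ladderKernel m) (i, false)) := by
    rw [resistanceMean_ladder m i true, resistanceMean_ladder m i false]
    ring
  simp only [h6, Finset.sum_sub_distrib, ← Finset.mul_sum, h3, h4] at h1
  simp only [mul_add (edgeDensity _ _ _) (_ / 2), Finset.sum_add_distrib, h1, h2]
  rw [sumSqDensity]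
  field_simp
  ring

theorem theorem4p3 (n : ℕ) (hn : 2 ≤ n) :
    (ladder n).genus = (n : ℝ) - 1 ∧
    (ladder n).phiInv =
      (3 * (n : ℝ) ^ 3 - 9 * (n : ℝ) ^ 2 - 5 * (n : ℝ) + 1) / (18 * ((n : ℝ) - 1)) +
        ((n : ℝ) - 6) * (2 * (n : ℝ) - 1) / (6 * √3 * ((n : ℝ) - 1)) *
          (1 - 2 / (1 - (2 - √3) ^ (2 * n))) ∧
    (ladder n).lambdaInv =
      (n : ℝ) * ((n : ℝ) + 4) * ((n : ℝ) - 1) / (12 * (2 * (n : ℝ) - 1)) ∧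
    (ladder n).epsilonInv =
      (3 * (n : ℝ) ^ 2 - 3 * (n : ℝ) + 10) * ((n : ℝ) - 2) / (9 * ((n : ℝ) - 1)) -
        ((n : ℝ) - 2) * ((n : ℝ) - 6) / (3 * √3 * ((n : ℝ) - 1)) *
          (1 - 2 / (1 - (2 - √3) ^ (2 * n))) ∧
    (ladder n).zInv =
      (3 * (n : ℝ) ^ 2 - 13) * (n : ℝ) / (36 * ((n : ℝ) - 1) ^ 2) +
        (n : ℝ) * ((n : ℝ) - 6) / (12 * √3 * ((n : ℝ) - 1) ^ 2) *
          (1 - 2 / (1 - (2 - √3) ^ (2 * n))) := by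
  obtain ⟨m, rfl⟩ : ∃ m, n = m + 1 := ⟨n - 1, by omega⟩
  have hm : 0 < m := by omega
  have hm0 : (m : ℝ) ≠ 0 := by exact_mod_cast hm.ne'
  have hm2 : (2 * (m : ℝ) + 1) ≠ 0 := by positivity
  have h3 : √(3 : ℝ) ≠ 0 := by positivity
  have hb := one_sub_two_div_eq (m + 1) (by omega)
  rw [Nat.cast_add_one] at hb
  rw [lambdaInv, phiInv, genus_ladder, totalLength_ladder, epsilonInv_ladder hm, zInv_ladder hm, hb,
    Nat.cast_add_one, add_sub_cancel_right]
  -- `field_simp` recognizes the denominator of `λ` only in this form.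
  have e : 2 * ((m : ℝ) + 1) - 1 = 2 * m + 1 := by ring
  rw [e]
  refine ⟨rfl, ?_, ?_, ?_, ?_⟩ <;> field_simp <;> ring

end
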